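/- **Theorem 8.** Let $n\ge 2$ be even, $m\ge 1$, and let $P_2,\dots,P_n$ be $1$-periodic $m\times m$ matrix functions on $\mathbb R$ with complex entries $p_{\nu,i,j}$ satisfying $p_{\nu,i,j}^{(n-\nu)}\in L_2[0,1]$; assume that the eigenvalues of $C=\int_0^1P_2(x)\,dx$ are simple. For $t\in\mathbb C$ let $L_t$ be the operator in $L_2^m[0,1]=L_2([0,1];\mathbb C^m)$ generated by $$l(y)=y^{(n)}+P_2y^{(n-2)}+P_3y^{(n-3)}+\dots+P_ny,\qquad y^{(i)}(1)=e^{it}y^{(i)}(0),\quad i=0,1,\dots,n-1,$$ (its domain consists of all $y\in W^{n,2}([0,1];\mathbb C^m)$ satisfying the boundary conditions), and for $z\in[0,1]$ let $L_{t,z}$ be the same operator with $P_\nu$ replaced by $zP_\nu$. Eigenvalues are counted with their algebraic multiplicity, the dimension of the space of eigenvectors and associated vectors. Let $0<h<\frac1{15\pi}$ and $n(2\pi)^{n-1}h<1$ (the second condition follows from the first if $n=2$). For $a\in\{0,\pi\}$ and an integer $k\ge0$ let $$D_k(a;r)=\{\lambda\in\mathbb C:\ |\lambda-(2\pi ki+ai)^n|<r\}.$$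 Then for each $a\in\{0,\pi\}$ there is a positive integer $N_0(a,h)$ such that for every integer $N=N(a,h)\ge N_0(a,h)$ the following hold. For all $t\in\mathbb C$ with $|t-a|\le h$ and all $z\in[0,1]$, all eigenvalues of $L_{t,z}$ lie in the union of the disks $D_k(a;N^{n-1})$, $0\le k<N$, and $D_k(a;k^{n-1})$, $k\ge N$. Moreover: (a) For all $t\in\mathbb C$ with $|t-a|\le h$ and all $k\ge N(a,h)$, the disk $D_k(a;k^{n-1})$ contains exactly $2m$ eigenvalues of $L_t$. (b) There is a ($C^1$, simple) closed curve $\Gamma(a)$, independent of $t$, such that for all $t\in\mathbb C$ with $|t-a|\le h$ no eigenvalue of $L_t$ lies on $\Gamma(a)$, an eigenvalue of $L_t$ is enclosed by $\Gamma(a)$ if and only if it lies in none of the disks $D_k(a;k^{n-1})$ with $k\ge N(a,h)$, and the number of eigenvalues of $L_t$ enclosed by $\Gamma(a)$ is exactly $K(a,h)$, where $K(0,h)=(2N(0,h)-1)m$ and $K(\pi,h)=2mN(\pi,h)$. -/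

import Mathlib

open MeasureTheory Set Filter Topology

noncomputable section

/-- Lebesgue measure on `[0,1]`. -/
abbrev unitMeasure : Measure ℝ := volume.restrict (Icc (0 : ℝ) 1)

/-- The Hilbert space `L₂^m[0,1]` of `ℂ^m`-valued square integrable functions. -/
abbrev L2Vec (m : ℕ) : Type := Lp (EuclideanSpace ℂ (Fin m)) 2 unitMeasure

/-- `SquareIntegrableDeriv s f`: the derivative `f^{(s)}` belongs to `L₂[0,1]`, i.e. `f` belongs
to the Sobolev space `W^{s,2}(0,1)`: it agrees a.e. with an `s`-fold iterated primitive of an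
`L₂` function. -/
def SquareIntegrableDeriv : ℕ → (ℝ → ℂ) → Prop
  | 0, f => MemLp f 2 unitMeasure
  | s + 1, f => ∃ (g : ℝ → ℂ) (c : ℂ), SquareIntegrableDeriv s g ∧
      ∀ᵐ x ∂unitMeasure, f x = c + ∫ u in (0 : ℝ)..x, g u

/-- `Y 0` has the derivatives `Y 1, …, Y n` on `[0,1]`: `Y 0, …, Y (n-1)` are absolutely
continuous, `Y (i+1)` is the derivative of `Y i`, and `Y n` is square integrable. -/
def IsDerivSeq {m : ℕ} (n : ℕ) (Y : ℕ → ℝ → EuclideanSpace ℂ (Fin m)) : Prop :=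
  (∀ i ≤ n, MemLp (Y i) 2 unitMeasure) ∧
  ∀ i < n, ∀ x ∈ Icc (0 : ℝ) 1, Y i x = Y i 0 + ∫ u in (0 : ℝ)..x, Y (i + 1) u

/-- The expression `y^{(n)} + P₂ y^{(n-2)} + ⋯ + P_n y`, where `Y i` stands for `y^{(i)}`. -/
def diffExpr {m : ℕ} (n : ℕ) (P : ℕ → ℝ → Matrix (Fin m) (Fin m) ℂ)
    (Y : ℕ → ℝ → EuclideanSpace ℂ (Fin m)) (x : ℝ) : EuclideanSpace ℂ (Fin m) :=
  Y n x + ∑ ν ∈ Finset.Icc 2 n, Matrix.toEuclideanLin (P ν x) (Y (n - ν) x)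

/-- `y^{(i)}(1) = e^{it} y^{(i)}(0)` for `i = 0, …, n-1`. -/
def QuasiPeriodic {m : ℕ} (n : ℕ) (t : ℂ) (Y : ℕ → ℝ → EuclideanSpace ℂ (Fin m)) : Prop :=
  ∀ i < n, Y i 1 = Complex.exp (Complex.I * t) • Y i 0

theorem IsDerivSeq.intervalIntegrable {m n : ℕ} {Y : ℕ → ℝ → EuclideanSpace ℂ (Fin m)}
    (hY : IsDerivSeq n Y) {i : ℕ} (hi : i ≤ n) {x : ℝ} (hx : x ∈ Icc (0 : ℝ) 1) :
    IntervalIntegrable (Y i) volume 0 x := by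
  have h : IntegrableOn (Y i) (Icc (0 : ℝ) 1) volume := (hY.1 i hi).integrable (by norm_num)
  rw [intervalIntegrable_iff_integrableOn_Ioc_of_le hx.1]
  exact h.mono_set (fun y hy => ⟨hy.1.le, hy.2.trans hx.2⟩)

/-- The graph of `L_t`: all pairs `(y, l(y))` with `y` in the domain of `L_t`. -/
def blochGraph {m : ℕ} (n : ℕ) (P : ℕ → ℝ → Matrix (Fin m) (Fin m) ℂ) (t : ℂ) :
    Submodule ℂ (L2Vec m × L2Vec m) where
  carrier := {p | ∃ Y : ℕ → ℝ → EuclideanSpace ℂ (Fin m), IsDerivSeq n Y ∧ QuasiPeriodic n t Y ∧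
    p.1 =ᵐ[unitMeasure] Y 0 ∧ p.2 =ᵐ[unitMeasure] diffExpr n P Y}
  zero_mem' := by
    refine ⟨fun _ _ => 0, ⟨fun i _ => MemLp.zero, fun i _ x _ => by simp⟩,
      fun i _ => by simp, Lp.coeFn_zero _ _ _, ?_⟩
    filter_upwards [Lp.coeFn_zero (EuclideanSpace ℂ (Fin m)) 2 unitMeasure] with x hx
    simpa [diffExpr] using hx
  add_mem' := by
    rintro p q ⟨Y, hY, hYt, hp1, hp2⟩ ⟨Z, hZ, hZt, hq1, hq2⟩
    refine ⟨fun i x => Y i x + Z i x, ⟨fun i hi => (hY.1 i hi).add (hZ.1 i hi), ?_⟩, ?_, ?_, ?_⟩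
    · intro i hi x hx
      simp only
      rw [intervalIntegral.integral_add (hY.intervalIntegrable hi hx)
        (hZ.intervalIntegrable hi hx), hY.2 i hi x hx, hZ.2 i hi x hx]
      abel
    · intro i hi
      simp only
      rw [hYt i hi, hZt i hi, smul_add]
    · filter_upwards [Lp.coeFn_add p.1 q.1, hp1, hq1] with x h h1 h2
      exact h.trans (congrArg₂ (· + ·) h1 h2)
    · filter_upwards [Lp.coeFn_add p.2 q.2, hp2, hq2] with x h h1 h2
      simp only [Prod.snd_add, h, Pi.add_apply, h1, h2, diffExpr, map_add, Finset.sum_add_distrib]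
      abel
  smul_mem' := by
    rintro c p ⟨Y, hY, hYt, hp1, hp2⟩
    refine ⟨fun i x => c • Y i x, ⟨fun i hi => (hY.1 i hi).const_smul c, ?_⟩, ?_, ?_, ?_⟩
    · intro i hi x hx
      simp only
      rw [intervalIntegral.integral_smul, hY.2 i hi x hx, smul_add]
    · intro i hi
      simp only
      rw [hYt i hi, smul_comm]
    · filter_upwards [Lp.coeFn_smul c p.1, hp1] with x h h1
      simp [h, h1]
    · filter_upwards [Lp.coeFn_smul c p.2, hp2] with x h h1
      simp only [Prod.smul_snd, h, Pi.smul_apply, h1, diffExpr, map_smul, smul_add,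
        Finset.smul_sum]

/-- `l(y)` depends only on the class of `y`, so that `blochGraph` is the graph of an operator. -/
theorem blochGraph_singleValued {m : ℕ} (n : ℕ) (P : ℕ → ℝ → Matrix (Fin m) (Fin m) ℂ) (t : ℂ)
    (p : L2Vec m × L2Vec m) (hp : p ∈ blochGraph n P t) (h0 : p.1 = 0) : p.2 = 0 := by
  obtain ⟨Y, hY, -, h1, h2⟩ := hp
  have key : ∀ i ≤ n, Y i =ᵐ[unitMeasure] 0 := by
    intro i
    induction i with
    | zero =>
      intro _
      rw [h0] at h1
      exact h1.symm.trans (Lp.coeFn_zero _ _ _)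
    | succ i ih =>
      intro hi
      have hint : IntervalIntegrable (Y (i + 1)) volume 0 1 :=
        hY.intervalIntegrable hi (by simp)
      have hc : ContinuousOn (Y i) (Icc 0 1) := by
        have hc' : ContinuousOn (fun x => Y i 0 + ∫ u in (0 : ℝ)..x, Y (i + 1) u) (Icc 0 1) := by
          refine continuousOn_const.add ?_
          have := intervalIntegral.continuousOn_primitive_interval' hint (a := 0) (by simp)
          rwa [uIcc_of_le zero_le_one] at this
        exact hc'.congr (fun x hx => hY.2 i hi x hx)
      have hz : EqOn (Y i) 0 (Icc 0 1) :=
        Measure.eqOn_Icc_of_ae_eq volume zero_ne_one (ih (by omega)) hc continuousOn_const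
      have hprim : ∀ x ∈ Icc (0 : ℝ) 1, ∫ u in (0 : ℝ)..x, Y (i + 1) u = 0 := by
        intro x hx
        have h := hY.2 i hi x hx
        rw [hz hx, hz (by simp : (0 : ℝ) ∈ Icc (0 : ℝ) 1)] at h
        simpa using h.symm
      have hd := hint.ae_hasDerivAt_integral
      have hIoo : ∀ᵐ x ∂(volume.restrict (Icc (0 : ℝ) 1)), x ∈ Ioo (0 : ℝ) 1 := by
        rw [← restrict_Ioo_eq_restrict_Icc]
        exact ae_restrict_mem measurableSet_Ioo
      filter_upwards [ae_restrict_of_ae hd, hIoo] with x hx hxI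
      have hd1 := hx (by rw [uIcc_of_le zero_le_one]; exact Ioo_subset_Icc_self hxI) 0 (by simp)
      have hd2 : HasDerivAt (fun y => ∫ u in (0 : ℝ)..y, Y (i + 1) u) 0 x := by
        refine (hasDerivAt_const x (0 : EuclideanSpace ℂ (Fin m))).congr_of_eventuallyEq ?_
        filter_upwards [Ioo_mem_nhds hxI.1 hxI.2] with y hy
        exact hprim y (Ioo_subset_Icc_self hy)
      exact hd1.unique hd2
  have hall : ∀ᵐ x ∂unitMeasure, ∀ i ≤ n, Y i x = 0 := by
    rw [ae_all_iff]
    intro i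
    by_cases hi : i ≤ n
    · filter_upwards [key i hi] with x hx _
      exact hx
    · exact Eventually.of_forall (fun x h => absurd h hi)
  apply Lp.ext
  filter_upwards [h2, hall, Lp.coeFn_zero (EuclideanSpace ℂ (Fin m)) 2 unitMeasure] with x hx h hz
  rw [hx, hz]
  simp [diffExpr, h n le_rfl, h (n - _) (Nat.sub_le _ _)]

/-- The operator `L_t` in `L₂^m[0,1]`, with domain the `y ∈ W^{n,2}` that satisfy the boundary
conditions. -/
def blochOperator {m : ℕ} (n : ℕ) (P : ℕ → ℝ → Matrix (Fin m) (Fin m) ℂ) (t : ℂ) :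
    L2Vec m →ₗ.[ℂ] L2Vec m :=
  (blochGraph n P t).toLinearPMap

theorem blochOperator_graph {m : ℕ} (n : ℕ) (P : ℕ → ℝ → Matrix (Fin m) (Fin m) ℂ) (t : ℂ) :
    (blochOperator n P t).graph = blochGraph n P t :=
  Submodule.toLinearPMap_graph_eq _ (blochGraph_singleValued n P t)

section Operators

variable {E : Type*} [AddCommGroup E] [Module ℂ E]

/-- `μ` is an eigenvalue of the (partially defined) operator `T`. -/
def IsEigenvalue (T : E →ₗ.[ℂ] E) (μ : ℂ) : Prop :=
  ∃ f : T.domain, (f : E) ≠ 0 ∧ T f = μ • (f : E)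

/-- The vectors `f` for which `(T - μ)^k f` is defined and equal to `0`. -/
def rootSpaceAux (T : E →ₗ.[ℂ] E) (μ : ℂ) : ℕ → Submodule ℂ E
  | 0 => ⊥
  | k + 1 => ((rootSpaceAux T μ k).comap (T.toFun - μ • T.domain.subtype)).map T.domain.subtype

/-- The root space: all eigenvectors and associated vectors of `T` at `μ`, and `0`. Its dimension
is the (algebraic) multiplicity of the eigenvalue `μ`. -/
def rootSpace (T : E →ₗ.[ℂ] E) (μ : ℂ) : Submodule ℂ E := ⨆ k, rootSpaceAux T μ k

/-- `T` has exactly `N` eigenvalues in `S`, counted with (algebraic) multiplicity. -/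
def HasEigenvalueCount (T : E →ₗ.[ℂ] E) (S : Set ℂ) (N : ℕ) : Prop :=
  {μ | μ ∈ S ∧ IsEigenvalue T μ}.Finite ∧
  (∀ μ ∈ S, FiniteDimensional ℂ (rootSpace T μ)) ∧
  ∑ᶠ μ ∈ S, Module.finrank ℂ (rootSpace T μ) = N

end Operators

/-- `Γ ⊆ ℂ` is a (continuously differentiable) simple closed curve. -/
def IsSimpleClosedCurve (Γ : Set ℂ) : Prop :=
  ∃ γ : ℝ → ℂ, ContDiff ℝ 1 γ ∧ Function.Periodic γ 1 ∧ InjOn γ (Ico 0 1) ∧ Γ = range γ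

/-- The points enclosed by `Γ`: those in the bounded components of the complement of `Γ`. -/
def inside (Γ : Set ℂ) : Set ℂ :=
  {w | w ∉ Γ ∧ Bornology.IsBounded (connectedComponentIn Γᶜ w)}

/-- The open disk of radius `r` around `(2πki + ai)^n`. -/
def eigenDisk (n : ℕ) (a : ℝ) (k : ℕ) (r : ℝ) : Set ℂ :=
  Metric.ball (((2 * Real.pi * k + a : ℝ) * Complex.I) ^ n) r

/-- The localization that singles out `N(a,h)`: for all `|t - a| ≤ h` and `z ∈ [0,1]`, every
eigenvalue of `L_{t,z} = L_t(0) + z (L_t - L_t(0))` (the operator with coefficients `z P_ν`) lies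
in a disk around `(2πki + ai)^n`, of radius `N^{n-1}` for `0 ≤ k < N` or `k^{n-1}` for `k ≥ N`. -/
def EigenvaluesLocalized {m : ℕ} (n : ℕ) (P : ℕ → ℝ → Matrix (Fin m) (Fin m) ℂ) (a h : ℝ)
    (N : ℕ) : Prop :=
  ∀ t : ℂ, ‖t - a‖ ≤ h → ∀ z ∈ Icc (0 : ℝ) 1, ∀ μ : ℂ,
    IsEigenvalue (blochOperator n (fun ν x => (z : ℂ) • P ν x) t) μ →
      (∃ k < N, μ ∈ eigenDisk n a k ((N : ℝ) ^ (n - 1))) ∨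
      (∃ k ≥ N, μ ∈ eigenDisk n a k ((k : ℝ) ^ (n - 1)))

/-- `Γ` is a closed curve through no eigenvalue of any `L_t`, `|t - a| ≤ h`, such that the
eigenvalues of `L_t` enclosed by `Γ` are exactly those outside all the disks around
`(2πki + ai)^n` of radius `k^{n-1}` with `k ≥ N`, and their number is `K`. -/
def EnclosesRemaining {m : ℕ} (n : ℕ) (P : ℕ → ℝ → Matrix (Fin m) (Fin m) ℂ) (a h : ℝ)
    (N K : ℕ) (Γ : Set ℂ) : Prop :=
  IsSimpleClosedCurve Γ ∧ ∀ t : ℂ, ‖t - a‖ ≤ h →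
    (∀ μ : ℂ, IsEigenvalue (blochOperator n P t) μ →
      μ ∉ Γ ∧ (μ ∈ inside Γ ↔ ∀ k ≥ N, μ ∉ eigenDisk n a k ((k : ℝ) ^ (n - 1)))) ∧
    HasEigenvalueCount (blochOperator n P t) (inside Γ) K

end

noncomputable section

/-! ### Eigenvalue counts from finite rank spectral projections -/

/-! The free operator `D^n` with the quasi-periodic boundary conditions is diagonal in the
exponentials `e^{i(2πk+t)x}`. Each `k : ℤ` contributes the eigenvalue `(i(2πk+t))^n` with
multiplicity `m`. Since `n` is even, the value at `t = a` depends only on `|2πk+a| = 2πp(k)+a`, so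
that two indices share a disk, except that `k = 0` is alone when `a = 0`. Replacing `a` by `t` moves
a free eigenvalue by at most about `n (2π p)^{n-1} h`, and `n (2π)^{n-1} h < 1` keeps it inside a
disk of radius `θ max(p,N)^{n-1}` with `θ < 1` (`exists_freeBound`).

Let `w` lie outside all these smaller disks. The symbol of `D^i (D^n - w)⁻¹` with `i ≤ n - 2` is
then bounded by a constant times `1 / max(|k|,N)`. This uses that no derivative of order `n - 1`
occurs in the perturbation. The `ℓ²` norm of the symbol tends to `0` as `N → ∞`. By Cauchy-Schwarz
the multiplier maps `L₂` into bounded functions with small norm, and these may be multiplied by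
matrices with `L₂` entries (`exists_mul_expSeries`). Hence perturbation times free resolvent is an
operator `B` with `‖B‖ ≤ 1/2`, and `R₀ (1 + zB)⁻¹` is the resolvent of `L_{t,z}` at `w` for every `z
∈ [0,1]` (`IsFreeResolvent.isResolventAt`). This proves the localization.

For the counts, the algebraic multiplicities inside a circle add up to the rank of the Riesz
projection (`hasEigenvalueCount_of_projection`). That rank does not change as `z` runs from `0` to
`1`, because projections at distance less than `1` have equal rank
(`hasEigenvalueCount_of_homotopy`). At `z = 0` the projection keeps exactly the Fourier coefficients
of the free eigenvalues inside, so the rank is `m` times their number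
(`hasEigenvalueCount_blochOperator`). This is applied to each disk with `k ≥ N`, and to a circle `Γ`
around `0` that separates the disks with `k < N` from the others. -/

theorem finrank_eq_finsum_maxGenEigenspace {F : Type*} [AddCommGroup F] [Module ℂ F]
    [FiniteDimensional ℂ F] (G : Module.End ℂ F) :
    ∑ᶠ μ : ℂ, Module.finrank ℂ (G.maxGenEigenspace μ) = Module.finrank ℂ F := by
  classical
  have hind := G.independent_maxGenEigenspace
  have hfin : {μ | G.maxGenEigenspace μ ≠ ⊥}.Finite :=
    WellFoundedGT.finite_ne_bot_of_iSupIndep hind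
  have : Fintype {μ // G.maxGenEigenspace μ ≠ ⊥} := hfin.fintype
  have hint : DirectSum.IsInternal
      (fun μ : {μ // G.maxGenEigenspace μ ≠ ⊥} => G.maxGenEigenspace μ) := by
    refine DirectSum.isInternal_submodule_of_iSupIndep_of_iSup_eq_top
      (hind.comp Subtype.val_injective) ?_
    rw [iSup_subtype]
    simpa only [iSup_ne_bot_subtype, ne_eq, iSup_subtype'] using
      ((iSup_ne_bot_subtype _).trans G.iSup_maxGenEigenspace_eq_top :
        ⨆ i : {i // G.maxGenEigenspace i ≠ ⊥}, G.maxGenEigenspace i = ⊤)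
  have e := LinearEquiv.ofBijective (DirectSum.coeLinearMap _) hint
  rw [← e.finrank_eq, Module.finrank_directSum]
  have hsub : Function.support (fun μ : ℂ => Module.finrank ℂ (G.maxGenEigenspace μ)) ⊆
      hfin.toFinset := by
    intro μ hμ
    simp only [Function.mem_support] at hμ
    simp only [Finite.coe_toFinset, mem_ofPred_eq]
    intro h0
    exact hμ (by rw [h0]; simp)
  rw [finsum_eq_sum_of_support_subset _ hsub]
  exact Finset.sum_subtype _ (by simp) _

section Spectral

variable {E : Type*} [NormedAddCommGroup E] [NormedSpace ℂ E]

/-- `R` is the resolvent `(T - w)⁻¹`. -/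
structure IsResolventAt (T : E →ₗ.[ℂ] E) (w : ℂ) (R : E →L[ℂ] E) : Prop where
  graph_mem : ∀ f, (R f, w • R f + f) ∈ T.graph
  left_inv : ∀ y : T.domain, R (T y - w • (y : E)) = y

namespace IsResolventAt

variable {T : E →ₗ.[ℂ] E} {v w : ℂ} {R S : E →L[ℂ] E}

theorem apply_eq (hR : IsResolventAt T w R) (f : E) :
    ∃ y : T.domain, (y : E) = R f ∧ T y = w • R f + f :=
  (LinearPMap.mem_graph_iff T).1 (hR.graph_mem f)

theorem injective (hR : IsResolventAt T w R) : Function.Injective R := by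
  rw [injective_iff_map_eq_zero]
  intro f hf
  obtain ⟨y, hy, hTy⟩ := hR.apply_eq f
  rw [hf] at hy hTy
  have : y = 0 := Subtype.ext hy
  rw [this] at hTy
  simpa using hTy.symm

theorem resolvent_identity (hR : IsResolventAt T w R) (hS : IsResolventAt T v S) :
    R - S = (w - v) • (R * S) := by
  ext f
  obtain ⟨y, hy, hTy⟩ := hS.apply_eq f
  have h := hR.left_inv y
  rw [hTy, hy] at h
  have h2 : v • S f + f - w • S f = f - (w - v) • S f := by
    rw [sub_smul]; abel
  rw [h2, map_sub, map_smul] at h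
  change R f - S f = (w - v) • R (S f)
  rw [sub_eq_iff_eq_add, ← sub_eq_iff_eq_add']
  exact h

theorem unique (hR : IsResolventAt T w R) (hS : IsResolventAt T w S) : R = S := by
  simpa [sub_eq_zero] using hR.resolvent_identity hS

theorem mul_comm (hR : IsResolventAt T w R) (hS : IsResolventAt T v S) : R * S = S * R := by
  by_cases h : w = v
  · subst h; rw [hR.unique hS]
  · have h1 := hR.resolvent_identity hS
    have h2 := hS.resolvent_identity hR
    have h3 : (w - v) • (R * S) = (w - v) • (S * R) := by
      rw [← h1, ← neg_sub, h2, ← neg_smul, neg_sub]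
    exact smul_right_injective _ (sub_ne_zero.2 h) h3

theorem apply_eigenvector (hR : IsResolventAt T w R) {μ : ℂ} {f : T.domain}
    (hf : T f = μ • (f : E)) : (μ - w) • R (f : E) = f := by
  have := hR.left_inv f
  rwa [hf, ← sub_smul, map_smul] at this

theorem not_isEigenvalue (hR : IsResolventAt T w R) : ¬ IsEigenvalue T w := by
  rintro ⟨f, hf0, hf⟩
  have := hR.apply_eigenvector hf
  simp at this
  exact hf0 (by simp [← this])

end IsResolventAt

/-- A spectral projection `P` of finite rank that fixes the eigenvectors for eigenvalues in `S` and
kills the others counts the eigenvalues in `S`. -/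
theorem hasEigenvalueCount_of_projection {T : E →ₗ.[ℂ] E} {w : ℂ} {A P : E →L[ℂ] E}
    (hA : IsResolventAt T w A) (hP : IsIdempotentElem P) (hPA : P * A = A * P)
    [FiniteDimensional ℂ P.range] {S : Set ℂ}
    (hin : ∀ μ ∈ S, ∀ f : T.domain, T f = μ • (f : E) → P f = f)
    (hout : ∀ μ ∉ S, ∀ f : T.domain, T f = μ • (f : E) → P f = 0) :
    HasEigenvalueCount T S (Module.finrank ℂ P.range) := by
  have hPP : ∀ f, P (P f) = P f := fun f => congrArg (fun Q : E →L[ℂ] E => Q f) hP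
  have hPAf : ∀ f, P (A f) = A (P f) := fun f => congrArg (fun Q : E →L[ℂ] E => Q f) hPA
  have hmem : ∀ f, f ∈ P.range ↔ P f = f := fun f =>
    ⟨by rintro ⟨g, rfl⟩; exact hPP g, fun h => ⟨f, h⟩⟩
  -- `T` and `P` commute
  have hcomm : ∀ f : T.domain, ∃ y : T.domain, (y : E) = P f ∧ T y = P (T f) := by
    intro f
    obtain ⟨y, hy, hTy⟩ := hA.apply_eq (P (T f - w • (f : E)))
    rw [← hPAf, hA.left_inv] at hy hTy
    refine ⟨y, hy, ?_⟩
    rw [hTy, map_sub, map_smul]; abel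
  -- the range of `P` lies in the domain
  have hdom : ∀ f ∈ P.range, f ∈ T.domain := by
    intro f hf
    have hmaps : ∀ g ∈ P.range, (A : E →ₗ[ℂ] E) g ∈ P.range := by
      intro g hg
      rw [hmem] at hg ⊢
      exact (hPAf g).trans (by rw [hg]; rfl)
    -- The resolvent is injective and preserves the finite dimensional range of `P`, hence maps it
    -- onto itself; its values lie in the domain.
    have hinj : Function.Injective ((A : E →ₗ[ℂ] E).restrict hmaps) := by
      intro x y hxy
      exact Subtype.ext (hA.injective (congrArg Subtype.val hxy))
    obtain ⟨g, hg⟩ := LinearMap.surjective_of_injective hinj ⟨f, hf⟩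
    obtain ⟨y, hy, -⟩ := hA.apply_eq g
    have : A g = f := congrArg Subtype.val hg
    rw [← this, ← hy]
    exact y.2
  let i : P.range →ₗ[ℂ] T.domain := Submodule.inclusion hdom
  have hTmaps : ∀ f : P.range, T (i f) ∈ P.range := by
    intro f
    obtain ⟨y, hy, hTy⟩ := hcomm (i f)
    have hf : P (i f : E) = i f := (hmem _).1 f.2
    rw [hf] at hy
    rw [Subtype.ext hy] at hTy
    exact (hmem _).2 hTy.symm
  -- The part of `T` in the range of `P`. Its generalized eigenspaces turn out to be the root spaces
  -- of `T` for `μ ∈ S`, and to vanish for `μ ∉ S`.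
  let G : Module.End ℂ P.range := (T.toFun ∘ₗ i).codRestrict P.range hTmaps
  have hG : ∀ f : P.range, ((G f : P.range) : E) = T (i f) := fun f => rfl
  have haux : ∀ μ ∈ S, ∀ k, rootSpaceAux T μ k =
      ((G.genEigenspace μ k).map P.range.subtype) := by
    intro μ hμ k
    induction k with
    | zero => simp [rootSpaceAux]
    | succ k ih =>
      ext f
      simp only [rootSpaceAux, Submodule.mem_map, Submodule.mem_comap, ih,
        Submodule.coe_subtype]
      constructor
      · rintro ⟨y, ⟨g, hg, hgy⟩, rfl⟩
        have hgy' : (g : E) = T y - μ • (y : E) := hgy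
        -- With `z = P y`: since `(T - μ) y` lies in the range of `P`, `(T - μ)(y - P y) = 0`. So
        -- `P` fixes `y - P y`, which it also kills, and `y = P y`.
        obtain ⟨z, hz, hTz⟩ := hcomm y
        have hfix := hin μ hμ (y - z) (by
          rw [LinearPMap.map_sub, hTz]
          have h1 : P (T y - μ • (y : E)) = T y - μ • (y : E) := by
            rw [← hgy']; exact (hmem _).1 g.2
          rw [map_sub, map_smul] at h1
          have h2 : T y - P (T y) = μ • (y : E) - μ • P y := by
            rw [sub_eq_sub_iff_add_eq_add] at h1 ⊢
            rw [add_comm (μ • (y : E)), h1, ]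
          rw [h2, ← smul_sub]
          simp [hz])
        have hy : P y = y := by
          simp only [AddSubgroupClass.coe_sub, hz, map_sub, hPP, sub_self] at hfix
          exact (sub_eq_zero.1 hfix.symm).symm
        refine ⟨⟨y, (hmem _).2 hy⟩, ?_, rfl⟩
        rw [Module.End.mem_genEigenspace_nat] at hg ⊢
        rw [LinearMap.mem_ker] at hg ⊢
        rw [pow_succ, Module.End.mul_apply]
        convert hg using 2
        apply Subtype.ext
        rw [hgy']
        rfl
      · rintro ⟨g, hg, rfl⟩
        rw [Module.End.mem_genEigenspace_nat, LinearMap.mem_ker, pow_succ,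
          Module.End.mul_apply] at hg
        refine ⟨i g, ⟨(G - μ • 1) g, ?_, rfl⟩, rfl⟩
        rw [Module.End.mem_genEigenspace_nat, LinearMap.mem_ker]
        exact hg
  have hroot : ∀ μ ∈ S, rootSpace T μ = (G.maxGenEigenspace μ).map P.range.subtype := by
    intro μ hμ
    rw [rootSpace, ← Module.End.iSup_genEigenspace_eq, Submodule.map_iSup]
    exact iSup_congr fun k => haux μ hμ k
  -- An eigenvector of `G` for such a `μ` would be both fixed and killed by `P`.
  have hout' : ∀ μ ∉ S, G.maxGenEigenspace μ = ⊥ := by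
    intro μ hμ
    by_contra hne
    have hev : G.HasEigenvalue μ :=
      (Module.End.hasUnifEigenvalue_iff_hasUnifEigenvalue_one (k := ⊤) (by simp)).1 hne
    obtain ⟨f, hf, hf0⟩ := hev.exists_hasEigenvector
    have h1 := hout μ hμ (i f) (by
      rw [← hG, Module.End.mem_eigenspace_iff.1 hf]; rfl)
    have h2 : P (f : E) = f := (hmem _).1 f.2
    exact hf0 (Subtype.ext (h2.symm.trans h1))
  refine ⟨?_, ?_, ?_⟩
  · have hfin : {μ | G.maxGenEigenspace μ ≠ ⊥}.Finite :=
      WellFoundedGT.finite_ne_bot_of_iSupIndep G.independent_maxGenEigenspace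
    refine hfin.subset ?_
    rintro μ ⟨hμ, f, hf0, hf⟩ h0
    have h1 : (f : E) ∈ rootSpaceAux T μ 1 := by
      refine Submodule.mem_map.2 ⟨f, ?_, rfl⟩
      rw [Submodule.mem_comap]
      simp only [rootSpaceAux, Submodule.mem_bot]
      exact sub_eq_zero.2 hf
    have h2 : (f : E) ∈ rootSpace T μ := (le_iSup (rootSpaceAux T μ) 1) h1
    rw [hroot μ hμ, h0, Submodule.map_bot, Submodule.mem_bot] at h2
    exact hf0 h2
  · intro μ hμ
    rw [hroot μ hμ]
    infer_instance
  · rw [← finrank_eq_finsum_maxGenEigenspace G]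
    refine finsum_congr fun μ => ?_
    by_cases hμ : μ ∈ S
    · simp only [hμ, finsum_true]
      rw [hroot μ hμ]
      exact LinearEquiv.finrank_eq
        (Submodule.equivMapOfInjective _ (Submodule.injective_subtype _) _).symm
    · rw [hout' μ hμ]; simp [hμ]

/-! ### Stability of the rank of a projection -/

/-- `P` is injective on the range of `Q`: if `Q f = f` and `P f = 0`, then `‖f‖ = ‖(P - Q) f‖`,
which forces `f = 0`. -/
theorem IsIdempotentElem.finrank_range_le {P Q : E →L[ℂ] E} (hQ : IsIdempotentElem Q)
    (h : ‖P - Q‖ < 1) [FiniteDimensional ℂ P.range] :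
    FiniteDimensional ℂ Q.range ∧ Module.finrank ℂ Q.range ≤ Module.finrank ℂ P.range := by
  let j : Q.range →ₗ[ℂ] P.range := ((P : E →ₗ[ℂ] E).codRestrict P.range
    (fun x => ⟨x, rfl⟩)) ∘ₗ Q.range.subtype
  have hj : Function.Injective j := by
    rw [injective_iff_map_eq_zero]
    rintro ⟨f, g, hg⟩ hf
    have hPf : P f = 0 := congrArg Subtype.val hf
    have hQf : Q f = f := by
      rw [← hg]; exact congrArg (fun A : E →L[ℂ] E => A g) hQ
    have h1 : ‖f‖ ≤ ‖P - Q‖ * ‖f‖ := by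
      have := (P - Q).le_opNorm f
      simpa [hPf, hQf] using this
    apply Subtype.ext
    by_contra hne
    have : 0 < ‖f‖ := norm_pos_iff.2 hne
    nlinarith
  exact ⟨FiniteDimensional.of_injective j hj, LinearMap.finrank_le_finrank_of_injective hj⟩

theorem IsIdempotentElem.finrank_range_eq {P Q : E →L[ℂ] E} (hP : IsIdempotentElem P)
    (hQ : IsIdempotentElem Q) (h : ‖P - Q‖ < 1) [FiniteDimensional ℂ P.range] :
    FiniteDimensional ℂ Q.range ∧ Module.finrank ℂ Q.range = Module.finrank ℂ P.range := by
  obtain ⟨h1, h2⟩ := hQ.finrank_range_le h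
  exact ⟨h1, h2.antisymm (hP.finrank_range_le (by rwa [norm_sub_rev])).2⟩

end Spectral

/-! ### Riesz projections of families of resolvents -/

section Riesz

variable {E : Type*} [NormedAddCommGroup E] [NormedSpace ℂ E]

/-- The Riesz projection `-(2πi)⁻¹ ∮ R(w) dw` of a family of resolvents. -/
def rieszProjection (R : ℂ → E →L[ℂ] E) (c : ℂ) (r : ℝ) : E →L[ℂ] E :=
  -((2 * Real.pi * Complex.I : ℂ)⁻¹ • ∮ w in C(c, r), R w)

theorem norm_rieszProjection_sub_le {R S : ℂ → E →L[ℂ] E} {c : ℂ} {r C : ℝ} (hr : 0 ≤ r)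
    (hR : CircleIntegrable R c r) (hS : CircleIntegrable S c r)
    (hC : ∀ w ∈ Metric.sphere c r, ‖R w - S w‖ ≤ C) :
    ‖rieszProjection R c r - rieszProjection S c r‖ ≤ r * C := by
  have : rieszProjection R c r - rieszProjection S c r =
      -((2 * Real.pi * Complex.I : ℂ)⁻¹ • ∮ w in C(c, r), (R w - S w)) := by
    rw [circleIntegral.integral_sub hR hS, rieszProjection, rieszProjection, smul_sub]
    abel
  rw [this, norm_neg]
  exact circleIntegral.norm_two_pi_i_inv_smul_integral_le_of_norm_le_const hr hC

/-- `R` is a bounded family of resolvents of `T` on the annulus `r₁ ≤ |w - c| ≤ r₂`. -/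
structure IsResolventFamily (T : E →ₗ.[ℂ] E) (R : ℂ → E →L[ℂ] E) (c : ℂ) (r₁ r₂ : ℝ) : Prop where
  isResolventAt : ∀ w, r₁ ≤ ‖w - c‖ → ‖w - c‖ ≤ r₂ → IsResolventAt T w (R w)
  bounded : ∃ C, ∀ w, r₁ ≤ ‖w - c‖ → ‖w - c‖ ≤ r₂ → ‖R w‖ ≤ C

namespace IsResolventFamily

variable {T : E →ₗ.[ℂ] E} {R : ℂ → E →L[ℂ] E} {c : ℂ} {r₁ r₂ : ℝ}

/-- The resolvent identity together with a bound `C` makes `R` Lipschitz with constant `C²`. -/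
theorem continuousOn (h : IsResolventFamily T R c r₁ r₂) :
    ContinuousOn R {w | r₁ ≤ ‖w - c‖ ∧ ‖w - c‖ ≤ r₂} := by
  obtain ⟨C, hC⟩ := h.bounded
  have hlip : LipschitzOnWith (Real.toNNReal (C * C)) R {w | r₁ ≤ ‖w - c‖ ∧ ‖w - c‖ ≤ r₂} := by
    refine LipschitzOnWith.of_dist_le_mul fun w hw v hv => ?_
    have hC0 : 0 ≤ C := (norm_nonneg _).trans (hC w hw.1 hw.2)
    rw [dist_eq_norm, dist_eq_norm, (h.isResolventAt w hw.1 hw.2).resolvent_identity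
      (h.isResolventAt v hv.1 hv.2), norm_smul, Real.coe_toNNReal _ (by positivity), mul_comm]
    gcongr
    exact (norm_mul_le _ _).trans (mul_le_mul (hC w hw.1 hw.2) (hC v hv.1 hv.2)
      (norm_nonneg _) hC0)
  exact hlip.continuousOn

theorem hasDerivAt (h : IsResolventFamily T R c r₁ r₂) {w : ℂ} (hw₁ : r₁ < ‖w - c‖)
    (hw₂ : ‖w - c‖ < r₂) : HasDerivAt R (R w * R w) w := by
  have hnhds : {v | r₁ ≤ ‖v - c‖ ∧ ‖v - c‖ ≤ r₂} ∈ 𝓝 w := by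
    have hn : Continuous fun v : ℂ => ‖v - c‖ := by fun_prop
    have h1 : IsOpen {v : ℂ | r₁ < ‖v - c‖ ∧ ‖v - c‖ < r₂} :=
      (isOpen_lt continuous_const hn).and (isOpen_lt hn continuous_const)
    exact mem_of_superset (h1.mem_nhds ⟨hw₁, hw₂⟩) fun v hv => ⟨hv.1.le, hv.2.le⟩
  have hcont : ContinuousAt R w := h.continuousOn.continuousAt hnhds
  rw [hasDerivAt_iff_tendsto_slope]
  have ht : Tendsto (fun v => R v * R w) (𝓝[≠] w) (𝓝 (R w * R w)) :=
    ((hcont.mul continuousAt_const).tendsto).mono_left nhdsWithin_le_nhds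
  refine ht.congr' ?_
  filter_upwards [self_mem_nhdsWithin, nhdsWithin_le_nhds hnhds] with v hv hv'
  rw [slope_def_module, (h.isResolventAt v hv'.1 hv'.2).resolvent_identity
    (h.isResolventAt w hw₁.le hw₂.le), smul_smul, inv_mul_cancel₀ (sub_ne_zero.2 hv), one_smul]

theorem circleIntegrable (h : IsResolventFamily T R c r₁ r₂) {r : ℝ} (hr0 : 0 ≤ r) (hr₁ : r₁ ≤ r)
    (hr₂ : r ≤ r₂) : CircleIntegrable R c r := by
  refine ContinuousOn.circleIntegrable hr0 (h.continuousOn.mono ?_)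
  intro w hw
  rw [mem_sphere_iff_norm] at hw
  exact ⟨hw ▸ hr₁, hw ▸ hr₂⟩

theorem rieszProjection_eq (h : IsResolventFamily T R c r₁ r₂) (h0 : 0 < r₁) (h12 : r₁ ≤ r₂) :
    rieszProjection R c r₂ = rieszProjection R c r₁ := by
  rw [rieszProjection, rieszProjection]
  congr 2
  refine Complex.circleIntegral_eq_of_differentiable_on_annulus_off_countable h0 h12
    countable_empty (h.continuousOn.mono ?_) ?_
  · intro w hw
    simp only [Set.mem_sdiff, mem_closedBall_iff_norm, mem_ball_iff_norm, not_lt] at hw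
    exact ⟨hw.2, hw.1⟩
  · intro w hw
    simp only [Set.mem_sdiff, mem_closedBall_iff_norm, mem_ball_iff_norm, not_le] at hw
    exact (h.hasDerivAt hw.1.2 hw.1.1).differentiableAt

variable [CompleteSpace E]

theorem rieszProjection_mul (h : IsResolventFamily T R c r₁ r₂) (h0 : 0 < r₁)
    (S : E →L[ℂ] E) {r : ℝ} (hr₁ : r₁ ≤ r) (hr₂ : r ≤ r₂) :
    S * rieszProjection R c r =
      -((2 * Real.pi * Complex.I : ℂ)⁻¹ • ∮ w in C(c, r), S * R w) := by
  have hint := h.circleIntegrable (h0.le.trans hr₁) hr₁ hr₂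
  rw [rieszProjection, mul_neg, mul_smul_comm]
  congr 2
  simp only [circleIntegral]
  rw [← ContinuousLinearMap.mul_apply' ℂ, ← ContinuousLinearMap.intervalIntegral_comp_comm _ hint.out]
  simp

theorem mul_rieszProjection (h : IsResolventFamily T R c r₁ r₂) (h0 : 0 < r₁)
    (S : E →L[ℂ] E) {r : ℝ} (hr₁ : r₁ ≤ r) (hr₂ : r ≤ r₂) :
    rieszProjection R c r * S =
      -((2 * Real.pi * Complex.I : ℂ)⁻¹ • ∮ w in C(c, r), R w * S) := by
  have hint := h.circleIntegrable (h0.le.trans hr₁) hr₁ hr₂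
  rw [rieszProjection, neg_mul, smul_mul_assoc]
  congr 2
  simp only [circleIntegral]
  have := ContinuousLinearMap.intervalIntegral_comp_comm
    ((ContinuousLinearMap.mul ℂ (E →L[ℂ] E)).flip S) hint.out
  simp only [ContinuousLinearMap.flip_apply, ContinuousLinearMap.mul_apply'] at this
  rw [← this]
  simp

theorem rieszProjection_comm (h : IsResolventFamily T R c r₁ r₂) (h0 : 0 < r₁) (h12 : r₁ ≤ r₂) :
    rieszProjection R c r₂ * R (c + r₂) = R (c + r₂) * rieszProjection R c r₂ := by
  have hc : ‖c + (r₂ : ℂ) - c‖ = r₂ := by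
    rw [add_sub_cancel_left, Complex.norm_real, Real.norm_of_nonneg (h0.le.trans h12)]
  rw [h.rieszProjection_mul h0 _ h12 le_rfl, h.mul_rieszProjection h0 _ h12 le_rfl]
  congr 2
  refine circleIntegral.integral_congr (h0.le.trans h12) fun w hw => ?_
  rw [mem_sphere_iff_norm] at hw
  exact (h.isResolventAt w (by rw [hw]; exact h12) hw.le).mul_comm
    (h.isResolventAt _ (by rw [hc]; exact h12) hc.le)

/-- The two-circle argument: one factor is moved to the inner circle, and the resolvent identity
splits `R v * R w` into two Cauchy kernels. On the inner circle this gives `R v * P = R v - G v`,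
where `G`, a Cauchy integral over the outer circle, is holomorphic inside it and so integrates to
`0`. -/
theorem isIdempotentElem_rieszProjection (h : IsResolventFamily T R c r₁ r₂) (h0 : 0 < r₁)
    (h12 : r₁ < r₂) : IsIdempotentElem (rieszProjection R c r₂) := by
  have h02 : 0 < r₂ := h0.trans h12
  have hpi : (2 * Real.pi * Complex.I : ℂ) ≠ 0 := Complex.two_pi_I_ne_zero
  have hint₂ := h.circleIntegrable h02.le h12.le le_rfl
  have hint₁ := h.circleIntegrable h0.le le_rfl h12.le
  set G : ℂ → E →L[ℂ] E := fun v =>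
    (2 * Real.pi * Complex.I : ℂ)⁻¹ • ∮ w in C(c, r₂), (w - v)⁻¹ • R w with hG
  have hGdiff : DifferentiableOn ℂ G (Metric.ball c r₂) := by
    lift r₂ to NNReal using h02.le
    rw [← Metric.eball_coe]
    exact (hasFPowerSeriesOn_cauchy_integral hint₂ h02).differentiableOn
  have hkey : ∀ v ∈ Metric.sphere c r₁, R v * rieszProjection R c r₂ = R v - G v := by
    intro v hv
    rw [mem_sphere_iff_norm] at hv
    have hvb : v ∈ Metric.ball c r₂ := by rw [mem_ball_iff_norm, hv]; exact h12
    have hRv := h.isResolventAt v hv.ge (hv.le.trans h12.le)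
    have hne : ∀ w ∈ Metric.sphere c r₂, w - v ≠ 0 := by
      intro w hw h0
      rw [mem_sphere_iff_norm] at hw
      rw [sub_eq_zero.1 h0, hv] at hw
      exact h12.ne hw
    have hcont : ContinuousOn (fun w : ℂ => (w - v)⁻¹) (Metric.sphere c r₂) :=
      ContinuousOn.inv₀ (by fun_prop) hne
    rw [h.rieszProjection_mul h0 _ h12.le le_rfl]
    have h1 : (∮ w in C(c, r₂), R v * R w) =
        (∮ w in C(c, r₂), (w - v)⁻¹ • R w) - ∮ w in C(c, r₂), (w - v)⁻¹ • R v := by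
      rw [← circleIntegral.integral_sub]
      · refine circleIntegral.integral_congr h02.le fun w hw => ?_
        have hw' := mem_sphere_iff_norm.1 hw
        have := (h.isResolventAt w (h12.le.trans hw'.ge) hw'.le)
        rw [← smul_sub, this.resolvent_identity hRv, smul_smul, inv_mul_cancel₀ (hne w hw),
          one_smul, this.mul_comm hRv]
      · exact ContinuousOn.circleIntegrable h02.le (hcont.smul (h.continuousOn.mono (by
          intro w hw
          have hw' := mem_sphere_iff_norm.1 hw
          exact ⟨h12.le.trans hw'.ge, hw'.le⟩)))
      · exact ContinuousOn.circleIntegrable h02.le (hcont.smul continuousOn_const)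
    rw [h1, circleIntegral.integral_smul_const, circleIntegral.integral_sub_inv_of_mem_ball hvb,
      smul_sub, smul_smul, inv_mul_cancel₀ hpi, one_smul, neg_sub]
  have hGc : ContinuousOn G (Metric.closedBall c r₁) :=
    hGdiff.continuousOn.mono (Metric.closedBall_subset_ball h12)
  have hG0 : (∮ v in C(c, r₁), G v) = 0 := by
    refine DiffContOnCl.circleIntegral_eq_zero h0.le ⟨hGdiff.mono
      (Metric.ball_subset_ball h12.le), ?_⟩
    rwa [closure_ball c h0.ne']
  rw [IsIdempotentElem]
  nth_rewrite 1 [h.rieszProjection_eq h0 h12.le]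
  rw [h.mul_rieszProjection h0 _ le_rfl h12.le,
    circleIntegral.integral_congr h0.le hkey, circleIntegral.integral_sub hint₁
      (ContinuousOn.circleIntegrable h0.le (hGc.mono Metric.sphere_subset_closedBall)),
    hG0, sub_zero, h.rieszProjection_eq h0 h12.le]
  rfl

theorem rieszProjection_apply (h : IsResolventFamily T R c r₁ r₂) (h0 : 0 < r₁) (h12 : r₁ ≤ r₂)
    (f : E) : rieszProjection R c r₂ f =
      -((2 * Real.pi * Complex.I : ℂ)⁻¹ • ∮ w in C(c, r₂), R w f) := by
  have hint := h.circleIntegrable (h0.le.trans h12) h12 le_rfl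
  change -((2 * Real.pi * Complex.I : ℂ)⁻¹ • (∮ w in C(c, r₂), R w) f) = _
  congr 2
  simp only [circleIntegral]
  have := ContinuousLinearMap.intervalIntegral_comp_comm (ContinuousLinearMap.apply ℂ E f) hint.out
  simp only [ContinuousLinearMap.apply_apply] at this
  rw [← this]
  rfl

/-- The resolvent acts on an eigenvector for `μ` as `(μ - w)⁻¹`, so these integrals are the values
of the Riesz projection on eigenvectors. They also give its Fourier coefficients in the free case.
-/
theorem _root_.circleIntegral_inv_smul {c μ : ℂ} {r : ℝ} (h0 : 0 < r) (f : E) :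
    (‖μ - c‖ < r → -((2 * Real.pi * Complex.I : ℂ)⁻¹ • ∮ w in C(c, r), (μ - w)⁻¹ • f) = f) ∧
    (r < ‖μ - c‖ → -((2 * Real.pi * Complex.I : ℂ)⁻¹ • ∮ w in C(c, r), (μ - w)⁻¹ • f) = 0) := by
  have h1 : (∮ w in C(c, r), (μ - w)⁻¹ • f) = -((∮ w in C(c, r), (w - μ)⁻¹) • f) := by
    rw [circleIntegral.integral_smul_const, ← neg_smul]
    congr 1
    simp only [circleIntegral, smul_eq_mul]
    rw [← intervalIntegral.integral_neg]
    refine intervalIntegral.integral_congr fun θ _ => ?_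
    rw [← neg_sub μ, inv_neg]; ring
  rw [h1]
  constructor
  · intro h
    rw [circleIntegral.integral_sub_inv_of_mem_ball (mem_ball_iff_norm.2 h), smul_neg, neg_neg,
      smul_smul, inv_mul_cancel₀ Complex.two_pi_I_ne_zero, one_smul]
  · intro h
    have : (∮ w in C(c, r), (w - μ)⁻¹) = 0 := by
      refine DiffContOnCl.circleIntegral_eq_zero h0.le (DifferentiableOn.diffContOnCl ?_)
      rw [closure_ball c h0.ne']
      intro w hw
      refine DifferentiableAt.differentiableWithinAt (DifferentiableAt.inv (by fun_prop) ?_)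
      rintro h2
      rw [sub_eq_zero.1 h2, mem_closedBall_iff_norm] at hw
      exact absurd h (not_lt.2 hw)
    rw [this]; simp

theorem hasEigenvalueCount (h : IsResolventFamily T R c r₁ r₂) (h0 : 0 < r₁) (h12 : r₁ < r₂)
    [FiniteDimensional ℂ (rieszProjection R c r₂).range] :
    HasEigenvalueCount T (Metric.ball c r₂)
      (Module.finrank ℂ (rieszProjection R c r₂).range) := by
  have h02 : 0 < r₂ := h0.trans h12
  have hc : ‖c + (r₂ : ℂ) - c‖ = r₂ := by
    rw [add_sub_cancel_left, Complex.norm_real, Real.norm_of_nonneg h02.le]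
  have hev : ∀ μ, ∀ f : T.domain, T f = μ • (f : E) → (f : E) ≠ 0 →
      ‖μ - c‖ ≠ r₂ ∧ rieszProjection R c r₂ f =
        -((2 * Real.pi * Complex.I : ℂ)⁻¹ • ∮ w in C(c, r₂), (μ - w)⁻¹ • (f : E)) := by
    intro μ f hf hf0
    have hne : ‖μ - c‖ ≠ r₂ := fun heq =>
      (h.isResolventAt μ (by rw [heq]; exact h12.le) heq.le).not_isEigenvalue ⟨f, hf0, hf⟩
    refine ⟨hne, ?_⟩
    rw [h.rieszProjection_apply h0 h12.le]
    congr 2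
    refine circleIntegral.integral_congr h02.le fun w hw => ?_
    rw [mem_sphere_iff_norm] at hw
    have hres := h.isResolventAt w (hw ▸ h12.le) hw.le
    have hmw : μ - w ≠ 0 := by
      intro h3
      rw [sub_eq_zero.1 h3] at hne
      exact hne hw
    rw [eq_inv_smul_iff₀ hmw]
    exact hres.apply_eigenvector hf
  refine hasEigenvalueCount_of_projection (h.isResolventAt _ (by rw [hc]; exact h12.le) hc.le)
    (h.isIdempotentElem_rieszProjection h0 h12) (h.rieszProjection_comm h0 h12.le) ?_ ?_
  · intro μ hμ f hf
    by_cases hf0 : (f : E) = 0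
    · simp [hf0]
    · rw [(hev μ f hf hf0).2]
      exact (circleIntegral_inv_smul h02 (f : E)).1 (mem_ball_iff_norm.1 hμ)
  · intro μ hμ f hf
    by_cases hf0 : (f : E) = 0
    · simp [hf0]
    · obtain ⟨h3, h4⟩ := hev μ f hf hf0
      rw [h4]
      rw [mem_ball_iff_norm, not_lt] at hμ
      exact (circleIntegral_inv_smul h02 (f : E)).2 (lt_of_le_of_ne hμ h3.symm)

end IsResolventFamily

variable [CompleteSpace E]

/-- The number of eigenvalues in a disk is constant along a Lipschitz family of resolvents. -/
theorem hasEigenvalueCount_of_homotopy {T : ℝ → E →ₗ.[ℂ] E} {R : ℝ → ℂ → E →L[ℂ] E} {c : ℂ}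
    {r₁ r₂ : ℝ} (h0 : 0 < r₁) (h12 : r₁ < r₂)
    (hR : ∀ z ∈ Icc (0 : ℝ) 1, IsResolventFamily (T z) (R z) c r₁ r₂) {C : ℝ}
    (hC : ∀ z ∈ Icc (0 : ℝ) 1, ∀ z' ∈ Icc (0 : ℝ) 1, ∀ w ∈ Metric.sphere c r₂,
      ‖R z w - R z' w‖ ≤ C * |z - z'|)
    [hfin : FiniteDimensional ℂ (rieszProjection (R 0) c r₂).range] :
    HasEigenvalueCount (T 1) (Metric.ball c r₂)
      (Module.finrank ℂ (rieszProjection (R 0) c r₂).range) := by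
  have h02 : 0 < r₂ := h0.trans h12
  -- One step of length `1/(M+1)` in `z` moves the projection by at most `r₂ C / (M+1) < 1`, which
  -- preserves its rank.
  obtain ⟨M, hM⟩ := exists_nat_gt (r₂ * C)
  have hM' : r₂ * C < (M + 1 : ℕ) := hM.trans (by exact_mod_cast M.lt_succ_self)
  have hpos : (0 : ℝ) < (M + 1 : ℕ) := by positivity
  have hmem : ∀ j ≤ M + 1, (j : ℝ) / (M + 1 : ℕ) ∈ Icc (0 : ℝ) 1 := fun j hj =>
    ⟨by positivity, (div_le_one hpos).2 (by exact_mod_cast hj)⟩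
  have key : ∀ j ≤ M + 1,
      FiniteDimensional ℂ (rieszProjection (R ((j : ℝ) / (M + 1 : ℕ))) c r₂).range ∧
      Module.finrank ℂ (rieszProjection (R ((j : ℝ) / (M + 1 : ℕ))) c r₂).range =
        Module.finrank ℂ (rieszProjection (R 0) c r₂).range := by
    intro j
    induction j with
    | zero =>
      intro _
      rw [Nat.cast_zero, zero_div]
      exact ⟨hfin, rfl⟩
    | succ j ih =>
      intro hj
      obtain ⟨h1, h2⟩ := ih (by omega)
      have hj1 := hmem j (by omega)
      have hj2 := hmem (j + 1) hj
      have hle := norm_rieszProjection_sub_le h02.le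
        ((hR _ hj1).circleIntegrable h02.le h12.le le_rfl)
        ((hR _ hj2).circleIntegrable h02.le h12.le le_rfl) (hC _ hj1 _ hj2)
      have habs : |(j : ℝ) / (M + 1 : ℕ) - (j + 1 : ℕ) / (M + 1 : ℕ)| = 1 / (M + 1 : ℕ) := by
        rw [← sub_div, Nat.cast_succ j, sub_add_cancel_left, abs_div, abs_neg, abs_one,
          abs_of_pos hpos]
      rw [habs, ← mul_assoc, mul_one_div] at hle
      have hlt := hle.trans_lt ((div_lt_one hpos).2 hM')
      obtain ⟨h3, h4⟩ := ((hR _ hj1).isIdempotentElem_rieszProjection h0 h12).finrank_range_eq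
        ((hR _ hj2).isIdempotentElem_rieszProjection h0 h12) hlt
      exact ⟨h3, h4.trans h2⟩
  obtain ⟨h1, h2⟩ := key (M + 1) le_rfl
  rw [div_self hpos.ne'] at h1 h2
  rw [← h2]
  exact (hR 1 (by simp)).hasEigenvalueCount h0 h12

end Riesz

/-! ### Fourier coefficients of vector valued functions on `[0,1]` -/

theorem integral_unitMeasure {F : Type*} [NormedAddCommGroup F] [NormedSpace ℝ F] (f : ℝ → F) :
    ∫ x, f x ∂unitMeasure = ∫ x in (0 : ℝ)..1, f x := by
  rw [intervalIntegral.integral_of_le zero_le_one, integral_Icc_eq_integral_Ioc]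

/-- The exponential `x ↦ e^{iκx}`. -/
def expI (κ : ℂ) (x : ℝ) : ℂ := Complex.exp (Complex.I * κ * x)

@[fun_prop]
theorem continuous_expI (κ : ℂ) : Continuous (expI κ) := by
  unfold expI; fun_prop

theorem expI_add (κ κ' : ℂ) (x : ℝ) : expI (κ + κ') x = expI κ x * expI κ' x := by
  rw [expI, expI, expI, ← Complex.exp_add]; congr 1; ring

@[simp] theorem expI_zero_right (κ : ℂ) : expI κ 0 = 1 := by simp [expI]

@[simp] theorem expI_zero_left (x : ℝ) : expI 0 x = 1 := by simp [expI]

theorem expI_ne_zero (κ : ℂ) (x : ℝ) : expI κ x ≠ 0 := Complex.exp_ne_zero _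

theorem norm_expI (κ : ℂ) (x : ℝ) : ‖expI κ x‖ = Real.exp (-(κ.im * x)) := by
  rw [expI, Complex.norm_exp]; congr 1; simp

theorem norm_expI_le (κ : ℂ) {x : ℝ} (hx : x ∈ Icc (0 : ℝ) 1) :
    ‖expI κ x‖ ≤ Real.exp |κ.im| := by
  rw [norm_expI, Real.exp_le_exp]
  have h1 := neg_abs_le κ.im
  have h2 := abs_nonneg κ.im
  nlinarith [hx.1, hx.2]

theorem star_expI_ofReal (κ x : ℝ) : (starRingEnd ℂ) (expI κ x) = expI (-κ) x := by
  rw [expI, ← Complex.exp_conj, expI]; congr 1; simp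

theorem hasDerivAt_expI (κ : ℂ) (x : ℝ) : HasDerivAt (expI κ) (Complex.I * κ * expI κ x) x := by
  have h1 : HasDerivAt (fun y : ℝ => Complex.I * κ * (y : ℂ)) (Complex.I * κ) x := by
    simpa using (Complex.ofRealCLM.hasDerivAt (x := x)).const_mul (Complex.I * κ)
  have := h1.cexp
  rwa [mul_comm (Complex.exp _)] at this

theorem integral_expI (κ : ℂ) (a b : ℝ) :
    ∫ x in a..b, Complex.I * κ * expI κ x = expI κ b - expI κ a :=
  intervalIntegral.integral_eq_sub_of_hasDerivAt (fun x _ => hasDerivAt_expI κ x)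
    (Continuous.intervalIntegrable (by fun_prop) _ _)

/-- The frequencies `2πk + t` of the Bloch exponentials. -/
def blochFreq (t : ℂ) (k : ℤ) : ℂ := 2 * Real.pi * k + t

theorem expI_two_pi_one (k : ℤ) : expI (2 * Real.pi * k) 1 = 1 := by
  rw [expI, ← Complex.exp_int_mul_two_pi_mul_I k]; congr 1; push_cast; ring

theorem expI_blochFreq_one (t : ℂ) (k : ℤ) :
    expI (blochFreq t k) 1 = Complex.exp (Complex.I * t) := by
  rw [blochFreq, expI_add, expI_two_pi_one, one_mul, expI]; simp

theorem blochFreq_im (t : ℂ) (k : ℤ) : (blochFreq t k).im = t.im := by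
  have : (2 * Real.pi * k : ℂ) = ((2 * Real.pi * k : ℝ) : ℂ) := by push_cast; ring
  rw [blochFreq, this, Complex.add_im, Complex.ofReal_im, zero_add]

section Scalar

theorem MeasureTheory.MemLp.continuous_mul {f a : ℝ → ℂ} (hf : MemLp f 2 unitMeasure)
    (ha : Continuous a) : MemLp (fun x => a x * f x) 2 unitMeasure := by
  obtain ⟨C, hC⟩ := (isCompact_Icc (a := (0 : ℝ)) (b := 1)).exists_bound_of_continuousOn
    ha.continuousOn
  refine MemLp.of_le_mul (c := C) hf (ha.aestronglyMeasurable.mul hf.1) ?_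
  filter_upwards [ae_restrict_mem measurableSet_Icc] with x hx
  rw [norm_mul]
  exact mul_le_mul_of_nonneg_right (hC x hx) (norm_nonneg _)

theorem hasSum_sq_integral_expI {f : ℝ → ℂ} (hf : MemLp f 2 unitMeasure) :
    HasSum (fun k : ℤ => ‖∫ x, expI (-(2 * Real.pi * k)) x * f x ∂unitMeasure‖ ^ 2)
      (∫ x, ‖f x‖ ^ 2 ∂unitMeasure) := by
  have hf' : MemLp f 2 (volume.restrict (Ioc (0 : ℝ) 1)) := by
    rwa [restrict_Ioc_eq_restrict_Icc]
  have h := hasSum_sq_fourierCoeffOn zero_lt_one hf'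
  simp only [fourierCoeffOn_eq_integral, sub_zero, inv_one, one_smul, ne_eq, one_ne_zero,
    not_false_eq_true, div_self] at h
  rw [integral_unitMeasure]
  convert h using 3 with k
  rw [integral_unitMeasure]
  congr 1
  refine intervalIntegral.integral_congr fun x _ => ?_
  simp only [smul_eq_mul]
  congr 1
  rw [fourier_coe_apply, expI]
  congr 1
  push_cast
  ring

/-- Parseval for `conj u + s v` with `s = 1, -1, I, -I`, combined by polarization. The conjugation
makes the result bilinear in `u` and `v`. -/
theorem hasSum_integral_expI_mul {u v : ℝ → ℂ} (hu : MemLp u 2 unitMeasure)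
    (hv : MemLp v 2 unitMeasure) :
    HasSum (fun k : ℤ => (∫ x, expI (2 * Real.pi * k) x * u x ∂unitMeasure) *
      ∫ x, expI (-(2 * Real.pi * k)) x * v x ∂unitMeasure) (∫ x, u x * v x ∂unitMeasure) := by
  have hcu : MemLp (fun x => (starRingEnd ℂ) (u x)) 2 unitMeasure := hu.star
  have key : ∀ s : ℂ, HasSum (fun k : ℤ =>
      ((‖(∫ x, expI (-(2 * Real.pi * k)) x * (starRingEnd ℂ) (u x) ∂unitMeasure) +
        s * ∫ x, expI (-(2 * Real.pi * k)) x * v x ∂unitMeasure‖ ^ 2 : ℝ) : ℂ))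
      (∫ x, ((‖(starRingEnd ℂ) (u x) + s * v x‖ ^ 2 : ℝ) : ℂ) ∂unitMeasure) := by
    intro s
    have h := hasSum_sq_integral_expI (hcu.add (hv.const_mul s))
    rw [← Complex.hasSum_ofReal, ← integral_complex_ofReal] at h
    refine Eq.mp (congrArg₂ (fun (F : ℤ → ℂ) (V : ℂ) => HasSum F V) (funext fun k => ?_) rfl) h
    congr 3
    rw [← integral_const_mul, ← integral_add]
    · refine integral_congr_ae (ae_of_all _ fun x => ?_)
      simp only [Pi.add_apply]; ring
    · exact (hcu.continuous_mul (continuous_expI _)).integrable (by norm_num)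
    · exact ((hv.continuous_mul (continuous_expI _)).integrable (by norm_num)).const_mul s
  have polar : ∀ a b : ℂ, (((‖(starRingEnd ℂ) a + 1 * b‖ ^ 2 : ℝ) : ℂ) -
      ((‖(starRingEnd ℂ) a + (-1) * b‖ ^ 2 : ℝ) : ℂ) -
      Complex.I * ((‖(starRingEnd ℂ) a + Complex.I * b‖ ^ 2 : ℝ) : ℂ) +
      Complex.I * ((‖(starRingEnd ℂ) a + (-Complex.I) * b‖ ^ 2 : ℝ) : ℂ)) / 4 = a * b := by
    intro a b
    simp only [Complex.ofReal_pow, ← Complex.conj_mul', map_add, map_mul, map_neg, map_one,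
      Complex.conj_conj, Complex.conj_I]
    ring_nf
    simp only [Complex.I_sq]
    ring
  have hint : ∀ s : ℂ, Integrable (fun x =>
      ((‖(starRingEnd ℂ) (u x) + s * v x‖ ^ 2 : ℝ) : ℂ)) unitMeasure := fun s =>
    ((hcu.add (hv.const_mul s)).integrable_norm_pow (by norm_num)).ofReal
  have h := ((((key 1).sub (key (-1))).sub ((key Complex.I).mul_left Complex.I)).add
    ((key (-Complex.I)).mul_left Complex.I)).div_const 4
  refine Eq.mp (congrArg₂ (fun (F : ℤ → ℂ) (V : ℂ) => HasSum F V) (funext fun k => ?_) ?_) h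
  · rw [← polar (∫ x, expI (2 * Real.pi * k) x * u x ∂unitMeasure), ← integral_conj]
    simp only [map_mul]
    have : ∀ x, (starRingEnd ℂ) (expI (2 * Real.pi * k) x) = expI (-(2 * Real.pi * k)) x := by
      intro x
      have := star_expI_ofReal (2 * Real.pi * k) x
      push_cast at this
      exact this
    simp only [this]
  · have h1 : Integrable (fun x => ((‖(starRingEnd ℂ) (u x) + 1 * v x‖ ^ 2 : ℝ) : ℂ) -
        ((‖(starRingEnd ℂ) (u x) + (-1) * v x‖ ^ 2 : ℝ) : ℂ)) unitMeasure := (hint 1).sub (hint _)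
    have h2 : Integrable (fun x => ((‖(starRingEnd ℂ) (u x) + 1 * v x‖ ^ 2 : ℝ) : ℂ) -
        ((‖(starRingEnd ℂ) (u x) + (-1) * v x‖ ^ 2 : ℝ) : ℂ) -
        Complex.I * ((‖(starRingEnd ℂ) (u x) + Complex.I * v x‖ ^ 2 : ℝ) : ℂ)) unitMeasure :=
      h1.sub ((hint _).const_mul _)
    rw [← integral_const_mul, ← integral_const_mul, ← integral_sub (hint _) (hint _),
      ← integral_sub h1 ((hint _).const_mul _), ← integral_add h2 ((hint _).const_mul _),
      ← integral_div]
    refine integral_congr_ae (ae_of_all _ fun x => ?_)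
    exact polar (u x) (v x)

end Scalar

section Vector

variable {m : ℕ}

/-- The Fourier coefficient `∫₀¹ e^{-iκx} f(x) dx`. -/
def expCoeff (κ : ℂ) (f : ℝ → EuclideanSpace ℂ (Fin m)) : EuclideanSpace ℂ (Fin m) :=
  ∫ x, expI (-κ) x • f x ∂unitMeasure

theorem MeasureTheory.MemLp.continuous_smul {f : ℝ → EuclideanSpace ℂ (Fin m)} {a : ℝ → ℂ}
    (hf : MemLp f 2 unitMeasure) (ha : Continuous a) :
    MemLp (fun x => a x • f x) 2 unitMeasure := by
  obtain ⟨C, hC⟩ := (isCompact_Icc (a := (0 : ℝ)) (b := 1)).exists_bound_of_continuousOn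
    ha.continuousOn
  refine MemLp.of_le_mul (c := C) hf (ha.aestronglyMeasurable.smul hf.1) ?_
  filter_upwards [ae_restrict_mem measurableSet_Icc] with x hx
  rw [norm_smul]
  exact mul_le_mul_of_nonneg_right (hC x hx) (norm_nonneg _)

theorem MeasureTheory.MemLp.integrable_expI_smul {f : ℝ → EuclideanSpace ℂ (Fin m)} (κ : ℂ)
    (hf : MemLp f 2 unitMeasure) : Integrable (fun x => expI κ x • f x) unitMeasure :=
  (hf.continuous_smul (continuous_expI κ)).integrable (by norm_num)

theorem MeasureTheory.MemLp.euclidean_apply {f : ℝ → EuclideanSpace ℂ (Fin m)}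
    (hf : MemLp f 2 unitMeasure) (j : Fin m) : MemLp (fun x => f x j) 2 unitMeasure :=
  (EuclideanSpace.proj (𝕜 := ℂ) j).comp_memLp' hf

theorem integral_euclidean_apply {μ : Measure ℝ} {f : ℝ → EuclideanSpace ℂ (Fin m)}
    (hf : Integrable f μ) (j : Fin m) : (∫ x, f x ∂μ) j = ∫ x, f x j ∂μ :=
  ((EuclideanSpace.proj (𝕜 := ℂ) j).integral_comp_comm hf).symm

theorem expCoeff_apply (κ : ℂ) {f : ℝ → EuclideanSpace ℂ (Fin m)} (hf : MemLp f 2 unitMeasure)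
    (j : Fin m) : expCoeff κ f j = ∫ x, expI (-κ) x * f x j ∂unitMeasure :=
  integral_euclidean_apply (hf.integrable_expI_smul _) j

theorem expCoeff_congr (κ : ℂ) {f g : ℝ → EuclideanSpace ℂ (Fin m)} (h : f =ᵐ[unitMeasure] g) :
    expCoeff κ f = expCoeff κ g :=
  integral_congr_ae (by filter_upwards [h] with x hx; rw [hx])

theorem expCoeff_add (κ : ℂ) {f g : ℝ → EuclideanSpace ℂ (Fin m)} (hf : MemLp f 2 unitMeasure)
    (hg : MemLp g 2 unitMeasure) :
    expCoeff κ (fun x => f x + g x) = expCoeff κ f + expCoeff κ g := by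
  simp only [expCoeff, smul_add]
  exact integral_add (hf.integrable_expI_smul _) (hg.integrable_expI_smul _)

theorem expCoeff_sub (κ : ℂ) {f g : ℝ → EuclideanSpace ℂ (Fin m)} (hf : MemLp f 2 unitMeasure)
    (hg : MemLp g 2 unitMeasure) :
    expCoeff κ (fun x => f x - g x) = expCoeff κ f - expCoeff κ g := by
  simp only [expCoeff, smul_sub]
  exact integral_sub (hf.integrable_expI_smul _) (hg.integrable_expI_smul _)

theorem expCoeff_smul (κ c : ℂ) (f : ℝ → EuclideanSpace ℂ (Fin m)) :
    expCoeff κ (fun x => c • f x) = c • expCoeff κ f := by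
  simp only [expCoeff, smul_comm _ c]
  exact integral_smul _ _

/-- The coefficients at the frequencies `2πk + t` are the ordinary Fourier coefficients of `e^{-itx}
f`, to which Parseval applies in each component. -/
theorem hasSum_sq_norm_expCoeff (t : ℂ) {f : ℝ → EuclideanSpace ℂ (Fin m)}
    (hf : MemLp f 2 unitMeasure) :
    HasSum (fun k : ℤ => ‖expCoeff (blochFreq t k) f‖ ^ 2)
      (∫ x, ‖expI (-t) x • f x‖ ^ 2 ∂unitMeasure) := by
  have hg := hf.continuous_smul (continuous_expI (-t))
  have h := hasSum_sum (s := Finset.univ) fun j _ => hasSum_sq_integral_expI (hg.euclidean_apply j)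
  have hint : ∀ j ∈ Finset.univ,
      Integrable (fun x => ‖(expI (-t) x • f x) j‖ ^ 2) unitMeasure := fun j _ =>
    (hg.euclidean_apply j).integrable_norm_pow (by norm_num)
  rw [← integral_finsetSum _ hint] at h
  simp only [EuclideanSpace.norm_sq_eq]
  convert h using 4 with k j
  rw [expCoeff_apply _ hf]
  congr 2
  funext x
  rw [blochFreq, neg_add, expI_add]
  simp [mul_assoc]

theorem ae_eq_of_expCoeff_eq (t : ℂ) {f g : ℝ → EuclideanSpace ℂ (Fin m)}
    (hf : MemLp f 2 unitMeasure) (hg : MemLp g 2 unitMeasure)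
    (h : ∀ k, expCoeff (blochFreq t k) f = expCoeff (blochFreq t k) g) : f =ᵐ[unitMeasure] g := by
  have hfg : MemLp (fun x => f x - g x) 2 unitMeasure := hf.sub hg
  have hs := hasSum_sq_norm_expCoeff t hfg
  simp only [expCoeff_sub _ hf hg, h, sub_self, norm_zero, ne_eq, OfNat.ofNat_ne_zero,
    not_false_eq_true, zero_pow] at hs
  have h0 := hs.unique hasSum_zero
  rw [integral_eq_zero_iff_of_nonneg (fun x => by positivity)
    ((hfg.continuous_smul (continuous_expI (-t))).integrable_norm_pow (by norm_num))] at h0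
  filter_upwards [h0] with x hx
  simpa [expI_ne_zero, sub_eq_zero] using hx

/-- Integration by parts for an indefinite integral against an exponential. -/
theorem expCoeff_eq_of_primitive (κ : ℂ) {f g : ℝ → EuclideanSpace ℂ (Fin m)}
    (hf : MemLp f 2 unitMeasure) (hg : MemLp g 2 unitMeasure)
    (hfg : ∀ x ∈ Icc (0 : ℝ) 1, f x = f 0 + ∫ u in (0 : ℝ)..x, g u) :
    expCoeff κ g = expI (-κ) 1 • f 1 - f 0 + (Complex.I * κ) • expCoeff κ f := by
  have hgi : Integrable g unitMeasure := hg.integrable (by norm_num)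
  set a : ℝ → ℂ := fun x => Complex.I * (-κ) * expI (-κ) x with ha
  have hac : Continuous a := by fun_prop
  have hai : Integrable a unitMeasure :=
    (hac.continuousOn.integrableOn_compact isCompact_Icc)
  -- Fubini on the triangle `u ≤ x` for `a(x) g(u)`, where `a` is the derivative of `e^{-iκx}`. It
  -- replaces the product rule, as `f` is only given as an indefinite integral.
  have hS : MeasurableSet {p : ℝ × ℝ | p.2 ≤ p.1} := measurableSet_le measurable_snd measurable_fst
  have hF : Integrable (fun p : ℝ × ℝ => {p : ℝ × ℝ | p.2 ≤ p.1}.indicator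
      (fun p => a p.1 • g p.2) p) (unitMeasure.prod unitMeasure) :=
    (hai.smul_prod hgi).indicator hS
  have hswap := integral_integral_swap (f := fun x u => {p : ℝ × ℝ | p.2 ≤ p.1}.indicator
      (fun p => a p.1 • g p.2) (x, u)) hF
  have hL : ∫ x, ∫ u, {p : ℝ × ℝ | p.2 ≤ p.1}.indicator (fun p => a p.1 • g p.2) (x, u)
      ∂unitMeasure ∂unitMeasure = ∫ x, a x • (f x - f 0) ∂unitMeasure := by
    refine integral_congr_ae ?_
    filter_upwards [ae_restrict_mem measurableSet_Icc] with x hx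
    rw [hfg x hx, add_sub_cancel_left, intervalIntegral.integral_of_le hx.1, ← integral_smul,
      ← integral_indicator measurableSet_Ioc]
    rw [integral_Icc_eq_integral_Ioc, ← integral_indicator measurableSet_Ioc]
    congr 1
    funext u
    simp only [indicator_apply, mem_Ioc, mem_ofPred_eq]
    by_cases h1 : 0 < u <;> by_cases h2 : u ≤ x <;> simp [h1, h2]
    intro h3
    exact absurd (h2.trans hx.2) (not_le.2 h3)
  have hR : ∫ u, ∫ x, {p : ℝ × ℝ | p.2 ≤ p.1}.indicator (fun p => a p.1 • g p.2) (x, u)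
      ∂unitMeasure ∂unitMeasure = ∫ u, (expI (-κ) 1 - expI (-κ) u) • g u ∂unitMeasure := by
    refine integral_congr_ae ?_
    filter_upwards [ae_restrict_mem measurableSet_Icc] with u hu
    rw [← integral_expI, intervalIntegral.integral_of_le hu.2, ← integral_smul_const,
      ← integral_Icc_eq_integral_Ioc, ← integral_indicator measurableSet_Icc,
      ← integral_indicator measurableSet_Icc]
    congr 1
    funext x
    simp only [indicator_apply, mem_Icc, mem_ofPred_eq]
    by_cases h1 : u ≤ x <;> by_cases h2 : x ≤ 1 <;> simp [h1, h2, ha]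
    intro h3
    exact absurd (hu.1.trans h1) (not_le.2 h3)
  rw [hL, hR] at hswap
  have h1 : ∫ x, a x • (f x - f 0) ∂unitMeasure =
      (-(Complex.I * κ)) • expCoeff κ f - (expI (-κ) 1 - 1) • f 0 := by
    simp only [smul_sub]
    rw [integral_sub, integral_smul_const]
    · congr 1
      · rw [expCoeff, ← integral_smul]
        congr 1; funext x; rw [smul_smul, ha]; ring_nf
      · rw [integral_unitMeasure, integral_expI, expI_zero_right]
    · exact (hf.continuous_smul hac).integrable (by norm_num)
    · exact hai.smul_const _
  have h2 : ∫ u, (expI (-κ) 1 - expI (-κ) u) • g u ∂unitMeasure =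
      expI (-κ) 1 • (f 1 - f 0) - expCoeff κ g := by
    simp only [sub_smul]
    rw [integral_sub (hgi.fun_smul _) (hg.integrable_expI_smul _), integral_smul,
      hfg 1 (by simp), add_sub_cancel_left, integral_unitMeasure]
    rfl
  rw [h1, h2] at hswap
  rw [smul_sub] at hswap
  have h3 := sub_eq_sub_iff_add_eq_add.1 hswap
  rw [sub_smul, one_smul, neg_smul] at h3
  have h4 : expCoeff κ g = expI (-κ) 1 • f 1 - expI (-κ) 1 • f 0 + (expI (-κ) 1 • f 0 - f 0) +
      (Complex.I * κ) • expCoeff κ f := by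
    rw [← h3]; abel
  rw [h4]; abel

/-- At `κ = 2πk + t` the boundary condition gives `e^{-iκ} f(1) = f(0)`, so that the boundary terms
cancel. -/
theorem expCoeff_deriv {t : ℂ} (k : ℤ) {f g : ℝ → EuclideanSpace ℂ (Fin m)}
    (hf : MemLp f 2 unitMeasure) (hg : MemLp g 2 unitMeasure)
    (hfg : ∀ x ∈ Icc (0 : ℝ) 1, f x = f 0 + ∫ u in (0 : ℝ)..x, g u)
    (hper : f 1 = Complex.exp (Complex.I * t) • f 0) :
    expCoeff (blochFreq t k) g = (Complex.I * blochFreq t k) • expCoeff (blochFreq t k) f := by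
  rw [expCoeff_eq_of_primitive _ hf hg hfg, hper, ← expI_blochFreq_one t k, smul_smul, ← expI_add]
  simp

/-- The primitive of `f` is the sum of the primitives of the terms of its Fourier series. -/
theorem hasSum_integral_expI_smul_expCoeff (t : ℂ) {f : ℝ → EuclideanSpace ℂ (Fin m)}
    (hf : MemLp f 2 unitMeasure) {x : ℝ} (hx : x ∈ Icc (0 : ℝ) 1) :
    HasSum (fun k : ℤ => (∫ u in (0 : ℝ)..x, expI (blochFreq t k) u) •
      expCoeff (blochFreq t k) f) (∫ u in (0 : ℝ)..x, f u) := by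
  have hind : ∀ g : ℝ → ℂ, ∫ u, (Ioc 0 x).indicator g u ∂unitMeasure = ∫ u in (0 : ℝ)..x, g u := by
    intro g
    rw [integral_indicator measurableSet_Ioc, intervalIntegral.integral_of_le hx.1,
      Measure.restrict_restrict measurableSet_Ioc]
    congr 2
    exact inter_eq_left.2 fun u hu => ⟨hu.1.le, hu.2.trans hx.2⟩
  have hcomp : ∀ j : Fin m, HasSum (fun k : ℤ => ((∫ u in (0 : ℝ)..x, expI (blochFreq t k) u) •
      expCoeff (blochFreq t k) f) j) ((∫ u in (0 : ℝ)..x, f u) j) := by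
    intro j
    -- The primitive at `x` is the pairing of `1_{(0,x]} e^{it·}` with `e^{-it·} f`, which bilinear
    -- Parseval expands.
    have hu : MemLp ((Ioc 0 x).indicator (expI t)) 2 unitMeasure := by
      refine MemLp.indicator measurableSet_Ioc ?_
      have := (memLp_const (μ := unitMeasure) (p := 2) (1 : ℂ)).continuous_mul (continuous_expI t)
      simpa using this
    have hv := (hf.euclidean_apply j).continuous_mul (continuous_expI (-t))
    have h := hasSum_integral_expI_mul hu hv
    have hlim : ∫ y, (Ioc 0 x).indicator (expI t) y * (expI (-t) y * f y j) ∂unitMeasure =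
        (∫ u in (0 : ℝ)..x, f u) j := by
      have hint : Integrable f (volume.restrict (Ioc 0 x)) :=
        IntegrableOn.mono_set (t := Icc 0 1) (hf.integrable (by norm_num))
          fun u hu => ⟨hu.1.le, hu.2.trans hx.2⟩
      rw [intervalIntegral.integral_of_le hx.1, integral_euclidean_apply hint,
        ← intervalIntegral.integral_of_le hx.1, ← hind]
      congr 1
      funext y
      simp only [indicator_apply]
      split_ifs
      · rw [← mul_assoc, ← expI_add]; simp
      · simp
    rw [hlim] at h
    convert h using 2 with k
    rw [PiLp.smul_apply, smul_eq_mul, expCoeff_apply _ hf]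
    congr 1
    · rw [← hind]
      congr 1
      funext y
      simp only [indicator_apply]
      split_ifs
      · rw [blochFreq, expI_add]
      · simp
    · congr 1
      funext y
      rw [blochFreq, neg_add, expI_add, mul_assoc]
  have h2 : HasSum (fun k : ℤ => WithLp.ofLp ((∫ u in (0 : ℝ)..x, expI (blochFreq t k) u) •
      expCoeff (blochFreq t k) f)) (WithLp.ofLp (∫ u in (0 : ℝ)..x, f u)) := Pi.hasSum.2 hcomp
  exact h2.mapL (PiLp.continuousLinearEquiv 2 ℂ (fun _ : Fin m => ℂ)).symm.toContinuousLinearMap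

end Vector

/-! ### Series of Bloch exponentials -/

section Series

variable {m : ℕ}

theorem summable_mul_and_tsum_mul_le {ι : Type*} {a b : ι → ℝ} (ha : ∀ i, 0 ≤ a i)
    (hb : ∀ i, 0 ≤ b i) (hsa : Summable fun i => a i ^ 2) (hsb : Summable fun i => b i ^ 2) :
    (Summable fun i => a i * b i) ∧
      ∑' i, a i * b i ≤ √(∑' i, a i ^ 2) * √(∑' i, b i ^ 2) := by
  have h := Real.summable_and_inner_le_Lp_mul_Lq_tsum_of_nonneg Real.HolderConjugate.two_two ha hb
    (by simpa using hsa) (by simpa using hsb)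
  simpa [Real.sqrt_eq_rpow] using h

theorem norm_sq_eq_integral (f : L2Vec m) : ‖f‖ ^ 2 = ∫ x, ‖f x‖ ^ 2 ∂unitMeasure := by
  have h := inner_self_eq_norm_sq_to_K (𝕜 := ℂ) f
  rw [L2.inner_def] at h
  simp only [inner_self_eq_norm_sq_to_K] at h
  have h2 : ((∫ x, ‖f x‖ ^ 2 ∂unitMeasure : ℝ) : ℂ) = ((‖f‖ ^ 2 : ℝ) : ℂ) := by
    rw [← integral_complex_ofReal]
    simpa using h
  exact_mod_cast h2.symm

theorem summable_sq_norm_expCoeff (t : ℂ) (f : L2Vec m) :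
    Summable fun k : ℤ => ‖expCoeff (blochFreq t k) f‖ ^ 2 :=
  (hasSum_sq_norm_expCoeff t (Lp.memLp f)).summable

theorem tsum_sq_norm_expCoeff_le (t : ℂ) (f : L2Vec m) :
    ∑' k : ℤ, ‖expCoeff (blochFreq t k) f‖ ^ 2 ≤ (Real.exp |t.im| * ‖f‖) ^ 2 := by
  have hf := Lp.memLp f
  rw [(hasSum_sq_norm_expCoeff t hf).tsum_eq, mul_pow, norm_sq_eq_integral, ← integral_const_mul]
  refine integral_mono_ae ?_ ?_ ?_
  · exact (hf.continuous_smul (continuous_expI (-t))).integrable_norm_pow (by norm_num)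
  · exact (hf.integrable_norm_pow (by norm_num)).const_mul _
  · filter_upwards [ae_restrict_mem measurableSet_Icc] with x hx
    rw [norm_smul, mul_pow]
    have := norm_expI_le (-t) hx
    rw [Complex.neg_im, abs_neg] at this
    gcongr

/-- The `k`-th term of `expSeries`. -/
def expTerm (t : ℂ) (d : ℤ → ℂ) (f : ℝ → EuclideanSpace ℂ (Fin m)) (k : ℤ) (x : ℝ) :
    EuclideanSpace ℂ (Fin m) :=
  (d k * expI (blochFreq t k) x) • expCoeff (blochFreq t k) f

/-- The Fourier multiplier with symbol `d`, applied to `f`. -/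
def expSeries (t : ℂ) (d : ℤ → ℂ) (f : ℝ → EuclideanSpace ℂ (Fin m)) (x : ℝ) :
    EuclideanSpace ℂ (Fin m) :=
  ∑' k, expTerm t d f k x

variable {t : ℂ} {d : ℤ → ℂ}

theorem continuous_expTerm (f : ℝ → EuclideanSpace ℂ (Fin m)) (k : ℤ) :
    Continuous (expTerm t d f k) := by
  unfold expTerm; fun_prop

theorem norm_expTerm_le (f : ℝ → EuclideanSpace ℂ (Fin m)) (k : ℤ) {x : ℝ}
    (hx : x ∈ Icc (0 : ℝ) 1) : ‖expTerm t d f k x‖ ≤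
      Real.exp |t.im| * (‖d k‖ * ‖expCoeff (blochFreq t k) f‖) := by
  rw [expTerm, norm_smul, norm_mul]
  have := norm_expI_le (blochFreq t k) hx
  rw [blochFreq_im] at this
  calc ‖d k‖ * ‖expI (blochFreq t k) x‖ * ‖expCoeff (blochFreq t k) f‖ ≤
      ‖d k‖ * Real.exp |t.im| * ‖expCoeff (blochFreq t k) f‖ := by gcongr
    _ = _ := by ring

theorem summable_mul_expCoeff (hd : Summable fun k => ‖d k‖ ^ 2) (f : L2Vec m) :
    Summable fun k => ‖d k‖ * ‖expCoeff (blochFreq t k) f‖ :=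
  (summable_mul_and_tsum_mul_le (fun _ => norm_nonneg _) (fun _ => norm_nonneg _) hd
    (summable_sq_norm_expCoeff t f)).1

theorem summable_expTerm (hd : Summable fun k => ‖d k‖ ^ 2) (f : L2Vec m) {x : ℝ}
    (hx : x ∈ Icc (0 : ℝ) 1) : Summable fun k => expTerm t d f k x :=
  .of_norm_bounded ((summable_mul_expCoeff hd f).mul_left _) fun k => norm_expTerm_le f k hx

/-- A square summable symbol maps `L₂` to bounded functions, by Cauchy-Schwarz. One factor `exp
|t.im|` bounds the exponentials, the other comes from Parseval for `e^{-itx} f`. -/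
theorem norm_expSeries_le (hd : Summable fun k => ‖d k‖ ^ 2) (f : L2Vec m) {x : ℝ}
    (hx : x ∈ Icc (0 : ℝ) 1) : ‖expSeries t d f x‖ ≤
      Real.exp |t.im| ^ 2 * √(∑' k, ‖d k‖ ^ 2) * ‖f‖ := by
  obtain ⟨h1, h2⟩ := summable_mul_and_tsum_mul_le (fun _ => norm_nonneg _) (fun _ => norm_nonneg _)
    hd (summable_sq_norm_expCoeff t f)
  have h3 : √(∑' k : ℤ, ‖expCoeff (blochFreq t k) f‖ ^ 2) ≤ Real.exp |t.im| * ‖f‖ :=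
    Real.sqrt_le_iff.2 ⟨by positivity, tsum_sq_norm_expCoeff_le t f⟩
  calc ‖expSeries t d f x‖ ≤
      Real.exp |t.im| * ∑' k, ‖d k‖ * ‖expCoeff (blochFreq t k) f‖ :=
        tsum_of_norm_bounded (h1.hasSum.mul_left _) fun k => norm_expTerm_le f k hx
    _ ≤ Real.exp |t.im| * (√(∑' k, ‖d k‖ ^ 2) * (Real.exp |t.im| * ‖f‖)) := by
        gcongr
        exact h2.trans (by gcongr)
    _ = _ := by ring

theorem continuousOn_expSeries (hd : Summable fun k => ‖d k‖ ^ 2) (f : L2Vec m) :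
    ContinuousOn (expSeries t d f) (Icc 0 1) :=
  continuousOn_tsum (fun k => (continuous_expTerm _ k).continuousOn)
    ((summable_mul_expCoeff hd f).mul_left _) fun k _ hx => norm_expTerm_le f k hx

theorem memLp_of_continuousOn {g : ℝ → EuclideanSpace ℂ (Fin m)} (hg : ContinuousOn g (Icc 0 1)) :
    MemLp g 2 unitMeasure := by
  obtain ⟨C, hC⟩ := isCompact_Icc.exists_bound_of_continuousOn hg
  refine MemLp.of_bound (hg.aestronglyMeasurable measurableSet_Icc) C ?_
  filter_upwards [ae_restrict_mem measurableSet_Icc] with x hx using hC x hx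

theorem memLp_expSeries (hd : Summable fun k => ‖d k‖ ^ 2) (f : L2Vec m) :
    MemLp (expSeries t d f) 2 unitMeasure :=
  memLp_of_continuousOn (continuousOn_expSeries hd f)

theorem integral_expI_blochFreq (t : ℂ) (k l : ℤ) :
    ∫ x, expI (-blochFreq t k) x * expI (blochFreq t l) x ∂unitMeasure = if l = k then 1 else 0 := by
  have h1 : ∀ x, expI (-blochFreq t k) x * expI (blochFreq t l) x =
      expI (2 * Real.pi * ((l - k : ℤ) : ℂ)) x := by
    intro x
    rw [← expI_add, blochFreq, blochFreq]
    congr 1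
    push_cast
    ring
  simp only [h1]
  split_ifs with h
  · subst h
    simp
  · have h2 := integral_expI (2 * Real.pi * ((l - k : ℤ) : ℂ)) 0 1
    rw [expI_two_pi_one, expI_zero_right, sub_self, intervalIntegral.integral_const_mul,
      mul_eq_zero] at h2
    rw [integral_unitMeasure]
    refine h2.resolve_left ?_
    simp [Real.pi_ne_zero, sub_eq_zero, h]

theorem expCoeff_expI_smul (t : ℂ) (k l : ℤ) (v : EuclideanSpace ℂ (Fin m)) :
    expCoeff (blochFreq t k) (fun x => expI (blochFreq t l) x • v) = if l = k then v else 0 := by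
  simp only [expCoeff, smul_smul]
  rw [integral_smul_const, integral_expI_blochFreq]
  split_ifs <;> simp

theorem expCoeff_expTerm (f : ℝ → EuclideanSpace ℂ (Fin m)) (k l : ℤ) :
    expCoeff (blochFreq t k) (expTerm t d f l) =
      if l = k then d k • expCoeff (blochFreq t k) f else 0 := by
  have : expTerm t d f l = fun x => d l • (expI (blochFreq t l) x •
      expCoeff (blochFreq t l) f) := by
    funext x; rw [expTerm, smul_smul]
  rw [this, expCoeff_smul, expCoeff_expI_smul]
  split_ifs with h
  · rw [h]
  · simp

theorem expCoeff_expSeries (hd : Summable fun k => ‖d k‖ ^ 2) (f : L2Vec m) (k : ℤ) :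
    expCoeff (blochFreq t k) (expSeries t d f) = d k • expCoeff (blochFreq t k) f := by
  have hcont : ∀ l, Continuous fun x => expI (-blochFreq t k) x • expTerm t d f l x := fun l =>
    (continuous_expI _).smul (continuous_expTerm _ l)
  have hint : ∀ l, Integrable (fun x => expI (-blochFreq t k) x • expTerm t d f l x)
      unitMeasure := fun l => (hcont l).continuousOn.integrableOn_compact isCompact_Icc
  have hb : ∀ l, ∀ x ∈ Icc (0 : ℝ) 1, ‖expI (-blochFreq t k) x • expTerm t d f l x‖ ≤
      Real.exp |t.im| * (Real.exp |t.im| * (‖d l‖ * ‖expCoeff (blochFreq t l) f‖)) := by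
    intro l x hx
    rw [norm_smul]
    have h1 := norm_expI_le (-blochFreq t k) hx
    rw [Complex.neg_im, blochFreq_im, abs_neg] at h1
    exact mul_le_mul h1 (norm_expTerm_le _ l hx) (norm_nonneg _) (Real.exp_nonneg _)
  have h := hasSum_integral_of_summable_integral_norm hint (by
    refine Summable.of_nonneg_of_le (fun l => by positivity) (fun l => ?_)
      (((summable_mul_expCoeff (t := t) hd f).mul_left (Real.exp |t.im|)).mul_left (Real.exp |t.im|))
    refine (integral_mono_ae (hint l).norm (integrable_const _) ?_).trans
      (?_ : ∫ _, Real.exp |t.im| * (Real.exp |t.im| * (‖d l‖ * ‖expCoeff (blochFreq t l) f‖))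
        ∂unitMeasure ≤ _)
    · filter_upwards [ae_restrict_mem measurableSet_Icc] with x hx using hb l x hx
    · simp)
  have h2 : ∫ x, ∑' l, expI (-blochFreq t k) x • expTerm t d f l x ∂unitMeasure =
      expCoeff (blochFreq t k) (expSeries t d f) := by
    refine integral_congr_ae ?_
    filter_upwards [ae_restrict_mem measurableSet_Icc] with x hx
    exact (summable_expTerm hd f hx).tsum_const_smul _
  rw [h2] at h
  refine h.unique ?_
  have h3 : ∀ l, ∫ x, expI (-blochFreq t k) x • expTerm t d f l x ∂unitMeasure =
      if l = k then d k • expCoeff (blochFreq t k) f else 0 := fun l => expCoeff_expTerm f k l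
  simp only [h3]
  exact hasSum_ite_eq k _

/-- The series is never differentiated term by term: the primitive of `g` is expanded by
`hasSum_integral_expI_smul_expCoeff` and compared with the series. Thus the symbol of `g` need not
be square summable, which matters for the derivative of order `n`. -/
theorem expSeries_eq_add_integral (hd : Summable fun k => ‖d k‖ ^ 2) (f : L2Vec m)
    {g : ℝ → EuclideanSpace ℂ (Fin m)} (hg : MemLp g 2 unitMeasure)
    (hfg : ∀ k, expCoeff (blochFreq t k) g =
      (Complex.I * blochFreq t k * d k) • expCoeff (blochFreq t k) f) {x : ℝ}
    (hx : x ∈ Icc (0 : ℝ) 1) :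
    expSeries t d f x = expSeries t d f 0 + ∫ u in (0 : ℝ)..x, g u := by
  have h := hasSum_integral_expI_smul_expCoeff t hg hx
  have h1 : ∀ k, (∫ u in (0 : ℝ)..x, expI (blochFreq t k) u) • expCoeff (blochFreq t k) g =
      expTerm t d f k x - expTerm t d f k 0 := by
    intro k
    have h2 := integral_expI (blochFreq t k) 0 x
    rw [intervalIntegral.integral_const_mul] at h2
    rw [hfg, smul_smul, expTerm, expTerm, ← sub_smul, ← mul_sub, ← h2]
    congr 1
    ring
  simp only [h1] at h
  have h0 := summable_expTerm (t := t) hd f (x := 0) (by simp)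
  have h3 := (summable_expTerm (t := t) hd f hx).hasSum.sub h0.hasSum
  rw [h.unique h3]
  simp only [expSeries]
  abel

theorem expSeries_one (f : ℝ → EuclideanSpace ℂ (Fin m)) :
    expSeries t d f 1 = Complex.exp (Complex.I * t) • expSeries t d f 0 := by
  rw [expSeries, expSeries, ← tsum_const_smul'']
  refine tsum_congr fun k => ?_
  rw [expTerm, expTerm, smul_smul, expI_blochFreq_one, expI_zero_right]
  congr 1
  ring

theorem expSeries_add (hd : Summable fun k => ‖d k‖ ^ 2) (f g : L2Vec m) {x : ℝ}
    (hx : x ∈ Icc (0 : ℝ) 1) :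
    expSeries t d (f + g : L2Vec m) x = expSeries t d f x + expSeries t d g x := by
  rw [expSeries, expSeries, expSeries,
    ← (summable_expTerm hd f hx).tsum_add (summable_expTerm hd g hx)]
  refine tsum_congr fun k => ?_
  rw [expTerm, expTerm, expTerm, ← smul_add, ← expCoeff_add _ (Lp.memLp f) (Lp.memLp g)]
  congr 1
  exact expCoeff_congr _ (Lp.coeFn_add f g)

theorem expSeries_smul (c : ℂ) (f : L2Vec m) (x : ℝ) :
    expSeries t d (c • f : L2Vec m) x = c • expSeries t d f x := by
  rw [expSeries, expSeries, ← tsum_const_smul'']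
  refine tsum_congr fun k => ?_
  have h : expCoeff (blochFreq t k) (c • f : L2Vec m) = c • expCoeff (blochFreq t k) f :=
    (expCoeff_congr _ (Lp.coeFn_smul c f)).trans (expCoeff_smul _ c f)
  rw [expTerm, expTerm, h, smul_comm]

/-! ### Matrix multiplication after a Fourier multiplier -/

/-- The sum of the absolute values of the entries of a matrix. -/
def entrySum (A : Matrix (Fin m) (Fin m) ℂ) : ℝ := ∑ i, ∑ j, ‖A i j‖

theorem entrySum_nonneg (A : Matrix (Fin m) (Fin m) ℂ) : 0 ≤ entrySum A := by
  unfold entrySum; positivity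

theorem norm_toEuclideanLin_le (A : Matrix (Fin m) (Fin m) ℂ) (v : EuclideanSpace ℂ (Fin m)) :
    ‖Matrix.toEuclideanLin A v‖ ≤ entrySum A * ‖v‖ := by
  have h1 : ‖Matrix.toEuclideanLin A v‖ ≤ ∑ i, ‖Matrix.toEuclideanLin A v i‖ := by
    rw [EuclideanSpace.norm_eq]
    refine Real.sqrt_le_iff.2 ⟨by positivity, ?_⟩
    exact Finset.sum_sq_le_sq_sum_of_nonneg fun i _ => norm_nonneg _
  refine h1.trans ?_
  rw [entrySum, Finset.sum_mul]
  refine Finset.sum_le_sum fun i _ => ?_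
  rw [Finset.sum_mul]
  have h2 : Matrix.toEuclideanLin A v i = ∑ j, A i j * v j := rfl
  rw [h2]
  refine (norm_sum_le _ _).trans (Finset.sum_le_sum fun j _ => ?_)
  rw [norm_mul]
  gcongr
  exact PiLp.norm_apply_le v j

theorem memLp_entrySum {A : ℝ → Matrix (Fin m) (Fin m) ℂ}
    (hA : ∀ i j, MemLp (fun x => A x i j) 2 unitMeasure) :
    MemLp (fun x => entrySum (A x)) 2 unitMeasure := by
  unfold entrySum
  exact memLp_finsetSum _ fun i _ => memLp_finsetSum _ fun j _ => (hA i j).norm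

theorem aestronglyMeasurable_toEuclideanLin {A : ℝ → Matrix (Fin m) (Fin m) ℂ}
    (hA : ∀ i j, MemLp (fun x => A x i j) 2 unitMeasure) {v : ℝ → EuclideanSpace ℂ (Fin m)}
    (hv : MemLp v 2 unitMeasure) :
    AEStronglyMeasurable (fun x => Matrix.toEuclideanLin (A x) (v x)) unitMeasure := by
  have h1 : AEStronglyMeasurable (fun x => fun i => ∑ j, A x i j * v x j) unitMeasure := by
    refine (aemeasurable_pi_lambda _ fun i => ?_).aestronglyMeasurable
    exact (Finset.aestronglyMeasurable_fun_sum _ fun j _ =>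
      (hA i j).1.mul (hv.euclidean_apply j).1).aemeasurable
  exact (PiLp.continuous_toLp 2 (fun _ : Fin m => ℂ)).comp_aestronglyMeasurable h1

/-- The operator `f ↦ A · expSeries t d f` on `L₂`, with its norm bound. -/
theorem exists_mul_expSeries {A : ℝ → Matrix (Fin m) (Fin m) ℂ}
    (hA : ∀ i j, MemLp (fun x => A x i j) 2 unitMeasure) (hd : Summable fun k => ‖d k‖ ^ 2) :
    ∃ B : L2Vec m →L[ℂ] L2Vec m,
      (∀ f : L2Vec m, B f =ᵐ[unitMeasure]
        fun x => Matrix.toEuclideanLin (A x) (expSeries t d f x)) ∧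
      ‖B‖ ≤ Real.exp |t.im| ^ 2 * √(∑' k, ‖d k‖ ^ 2) *
        (eLpNorm (fun x => entrySum (A x)) 2 unitMeasure).toReal := by
  set S := Real.exp |t.im| ^ 2 * √(∑' k, ‖d k‖ ^ 2) with hS
  have hS0 : 0 ≤ S := by positivity
  have hle : ∀ f : L2Vec m, ∀ᵐ x ∂unitMeasure,
      ‖Matrix.toEuclideanLin (A x) (expSeries t d f x)‖ ≤ (S * ‖f‖) * ‖entrySum (A x)‖ := by
    intro f
    filter_upwards [ae_restrict_mem measurableSet_Icc] with x hx
    rw [Real.norm_of_nonneg (entrySum_nonneg _), mul_comm (S * ‖f‖)]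
    exact (norm_toEuclideanLin_le _ _).trans
      (mul_le_mul_of_nonneg_left (norm_expSeries_le hd f hx) (entrySum_nonneg _))
  have hmem : ∀ f : L2Vec m,
      MemLp (fun x => Matrix.toEuclideanLin (A x) (expSeries t d f x)) 2 unitMeasure := fun f =>
    MemLp.of_le_mul (memLp_entrySum hA)
      (aestronglyMeasurable_toEuclideanLin hA (memLp_expSeries hd f)) (hle f)
  let B₀ : L2Vec m →ₗ[ℂ] L2Vec m :=
    { toFun := fun f => (hmem f).toLp
      map_add' := fun f g => by
        rw [← MemLp.toLp_add]
        refine MemLp.toLp_congr _ _ ?_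
        filter_upwards [ae_restrict_mem measurableSet_Icc] with x hx
        simp only [Pi.add_apply]
        rw [expSeries_add hd f g hx, map_add]
      map_smul' := fun c f => by
        rw [RingHom.id_apply, ← MemLp.toLp_const_smul]
        refine MemLp.toLp_congr _ _ (ae_of_all _ fun x => ?_)
        simp only [Pi.smul_apply]
        rw [expSeries_smul, map_smul] }
  refine ⟨B₀.mkContinuous (S * (eLpNorm (fun x => entrySum (A x)) 2 unitMeasure).toReal) ?_,
    fun f => (hmem f).coeFn_toLp, LinearMap.mkContinuous_norm_le _ (by positivity) _⟩
  intro f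
  change ‖(hmem f).toLp‖ ≤ _
  rw [Lp.norm_toLp]
  have h := eLpNorm_le_mul_eLpNorm_of_ae_le_mul (hle f) 2
  have h2 := ENNReal.toReal_mono (ENNReal.mul_ne_top ENNReal.ofReal_ne_top
    (memLp_entrySum hA).2.ne) h
  rw [ENNReal.toReal_mul, ENNReal.toReal_ofReal (by positivity)] at h2
  refine h2.trans (le_of_eq ?_)
  ring

end Series

/-! ### The resolvent of the Bloch operator -/

section Resolvent

variable {m n : ℕ} {t w : ℂ}

theorem two_pi_mul_abs_sub_le_norm (t : ℂ) (k : ℤ) :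
    2 * Real.pi * |(k : ℝ)| - ‖t‖ ≤ ‖Complex.I * blochFreq t k‖ := by
  have h1 : ‖(2 * Real.pi * k : ℂ)‖ = 2 * Real.pi * |(k : ℝ)| := by
    rw [norm_mul, norm_mul, Complex.norm_real, Real.norm_of_nonneg Real.pi_pos.le]
    simp
  rw [norm_mul, Complex.norm_I, one_mul, blochFreq, ← h1]
  exact norm_sub_le_norm_add _ _

theorem tendsto_norm_blochFreq (t : ℂ) :
    Tendsto (fun k : ℤ => ‖Complex.I * blochFreq t k‖) cofinite atTop := by
  have h1 : Tendsto (fun k : ℤ => |(k : ℝ)|) cofinite atTop := by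
    have := tendsto_norm_cocompact_atTop (E := ℤ)
    rw [cocompact_eq_cofinite] at this
    exact this.congr Int.norm_eq_abs
  refine tendsto_atTop_mono (fun k => ?_) (tendsto_atTop_add_const_right _ (-‖t‖) h1)
  have h2 := two_pi_mul_abs_sub_le_norm t k
  have h3 := Real.pi_gt_three
  nlinarith [abs_nonneg (k : ℝ)]

/-- The Fourier multiplier of `D^i (D^n - w)⁻¹`. -/
def freeMultiplier (n : ℕ) (t w : ℂ) (i : ℕ) (k : ℤ) : ℂ :=
  (Complex.I * blochFreq t k) ^ i / ((Complex.I * blochFreq t k) ^ n - w)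

/-- For large `|k|` the denominator is at least half of `|2πk+t|^n`, so the symbol is at most
`2/|k|`. -/
theorem summable_sq_freeMultiplier (t w : ℂ) {i : ℕ} (hi : i < n) :
    Summable fun k => ‖freeMultiplier n t w i k‖ ^ 2 := by
  have hs : Summable fun k : ℤ => 4 * (1 / (k : ℝ) ^ 2) :=
    (Real.summable_one_div_int_pow.2 one_lt_two).mul_left 4
  have hk : ∀ᶠ k : ℤ in cofinite, k ≠ 0 := (finite_singleton (0 : ℤ)).compl_mem_cofinite
  refine hs.of_norm_bounded_eventually ?_
  filter_upwards [(tendsto_norm_blochFreq t).eventually_ge_atTop 1,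
    (tendsto_norm_blochFreq t).eventually_ge_atTop (2 * ‖w‖),
    (tendsto_norm_blochFreq t).eventually_ge_atTop (2 * ‖t‖), hk] with k h1 h2 h3 h0
  set x := ‖Complex.I * blochFreq t k‖ with hx
  have hx0 : 0 < x := by linarith
  have hkx : |(k : ℝ)| ≤ x := by
    have h5 := two_pi_mul_abs_sub_le_norm t k
    rw [← hx] at h5
    have h7 := Real.pi_gt_three
    nlinarith [abs_nonneg (k : ℝ)]
  have hk0 : 0 < |(k : ℝ)| := abs_pos.2 (by exact_mod_cast h0)
  have hxn : x ≤ x ^ n := le_self_pow₀ h1 (by omega)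
  have hden : x ^ n / 2 ≤ ‖(Complex.I * blochFreq t k) ^ n - w‖ := by
    have := norm_sub_norm_le ((Complex.I * blochFreq t k) ^ n) w
    rw [norm_pow] at this
    linarith
  have hle : ‖freeMultiplier n t w i k‖ ≤ 2 / |(k : ℝ)| := by
    rw [freeMultiplier, norm_div, norm_pow, ← hx, div_le_div_iff₀ (by
      have : 0 < x ^ n / 2 := by positivity
      linarith) hk0]
    have h8 : x ^ i * x ≤ x ^ n := by
      rw [← pow_succ]; exact pow_le_pow_right₀ h1 hi
    have h9 : x ^ i * |(k : ℝ)| ≤ x ^ i * x := by gcongr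
    linarith
  rw [norm_pow, norm_norm]
  calc ‖freeMultiplier n t w i k‖ ^ 2 ≤ (2 / |(k : ℝ)|) ^ 2 := by gcongr
    _ = _ := by rw [div_pow, sq_abs]; ring

/-- The solution `Y 0` of `Y 0^{(n)} - w Y 0 = f` and its derivatives `Y i`. -/
def freeSolution (n : ℕ) (t w : ℂ) (f : ℝ → EuclideanSpace ℂ (Fin m)) (i : ℕ) (x : ℝ) :
    EuclideanSpace ℂ (Fin m) :=
  if i < n then expSeries t (freeMultiplier n t w i) f x
  -- The symbol of `D^n (D^n - w)⁻¹` tends to `1` and has no pointwise convergent series, so the top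
  -- derivative is defined by the equation itself.
  else w • expSeries t (freeMultiplier n t w 0) f x + f x

theorem freeSolution_of_lt (f : ℝ → EuclideanSpace ℂ (Fin m)) {i : ℕ} (hi : i < n) :
    freeSolution n t w f i = expSeries t (freeMultiplier n t w i) f := by
  funext x; simp [freeSolution, hi]

theorem freeSolution_self (f : ℝ → EuclideanSpace ℂ (Fin m)) (hn : 0 < n) :
    freeSolution n t w f n = fun x => w • freeSolution n t w f 0 x + f x := by
  funext x; simp [freeSolution, hn]

theorem memLp_freeSolution (hn : 0 < n) (f : L2Vec m) {i : ℕ} (hi : i ≤ n) :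
    MemLp (freeSolution n t w f i) 2 unitMeasure := by
  rcases hi.lt_or_eq with h | h
  · rw [freeSolution_of_lt _ h]
    exact memLp_expSeries (summable_sq_freeMultiplier t w h) f
  · rw [h, freeSolution_self _ hn, freeSolution_of_lt _ hn]
    exact ((memLp_expSeries (summable_sq_freeMultiplier t w hn) f).const_smul w).add (Lp.memLp f)

theorem expCoeff_freeSolution (hn : 0 < n) (hw : ∀ k, (Complex.I * blochFreq t k) ^ n ≠ w)
    (f : L2Vec m) {i : ℕ} (hi : i ≤ n) (k : ℤ) :
    expCoeff (blochFreq t k) (freeSolution n t w f i) =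
      freeMultiplier n t w i k • expCoeff (blochFreq t k) f := by
  rcases hi.lt_or_eq with h | h
  · rw [freeSolution_of_lt _ h, expCoeff_expSeries (summable_sq_freeMultiplier t w h)]
  · have h0 := summable_sq_freeMultiplier t w hn
    have hmem : MemLp (fun x => w • expSeries t (freeMultiplier n t w 0) f x) 2 unitMeasure :=
      (memLp_expSeries h0 f).const_smul w
    rw [h, freeSolution_self _ hn, freeSolution_of_lt _ hn, expCoeff_add _ hmem (Lp.memLp f),
      expCoeff_smul, expCoeff_expSeries h0, smul_smul]
    nth_rewrite 2 [← one_smul ℂ (expCoeff (blochFreq t k) f)]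
    rw [← add_smul]
    congr 1
    rw [freeMultiplier, freeMultiplier, pow_zero]
    field_simp [sub_ne_zero.2 (hw k)]
    ring

theorem isDerivSeq_freeSolution (hn : 0 < n) (hw : ∀ k, (Complex.I * blochFreq t k) ^ n ≠ w)
    (f : L2Vec m) : IsDerivSeq n (freeSolution n t w f) := by
  refine ⟨fun i hi => memLp_freeSolution hn f hi, fun i hi x hx => ?_⟩
  have hg := memLp_freeSolution (t := t) (w := w) hn f (i := i + 1) hi
  rw [freeSolution_of_lt _ hi]
  refine expSeries_eq_add_integral (summable_sq_freeMultiplier t w hi) f hg (fun k => ?_) hx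
  rw [expCoeff_freeSolution hn hw f hi]
  congr 1
  rw [freeMultiplier, freeMultiplier, pow_succ]
  ring

theorem quasiPeriodic_freeSolution (f : L2Vec m) :
    QuasiPeriodic n t (freeSolution n t w f) := by
  intro i hi
  rw [freeSolution_of_lt _ hi]
  exact expSeries_one _

theorem expCoeff_of_isDerivSeq {Y : ℕ → ℝ → EuclideanSpace ℂ (Fin m)} (hY : IsDerivSeq n Y)
    (hYt : QuasiPeriodic n t Y) {i : ℕ} (hi : i ≤ n) (k : ℤ) :
    expCoeff (blochFreq t k) (Y i) =
      (Complex.I * blochFreq t k) ^ i • expCoeff (blochFreq t k) (Y 0) := by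
  induction i with
  | zero => simp
  | succ i ih =>
    rw [expCoeff_deriv k (hY.1 i (by omega)) (hY.1 (i + 1) hi) (hY.2 i hi) (hYt i hi),
      ih (by omega), smul_smul, pow_succ']

/-- Uniqueness for the free equation: each derivative multiplies the coefficients by `i(2πk+t)`, so
the coefficients of `Y 0`, and with them those of `Y i`, are determined by those of `g`. -/
theorem ae_eq_freeSolution (hn : 0 < n) (hw : ∀ k, (Complex.I * blochFreq t k) ^ n ≠ w)
    {Y : ℕ → ℝ → EuclideanSpace ℂ (Fin m)} (hY : IsDerivSeq n Y) (hYt : QuasiPeriodic n t Y)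
    {g : L2Vec m} (hg : g =ᵐ[unitMeasure] fun x => Y n x - w • Y 0 x) {i : ℕ} (hi : i ≤ n) :
    Y i =ᵐ[unitMeasure] freeSolution n t w g i := by
  refine ae_eq_of_expCoeff_eq t (hY.1 i hi) (memLp_freeSolution hn g hi) fun k => ?_
  have h0 : MemLp (fun x => w • Y 0 x) 2 unitMeasure := (hY.1 0 (by omega)).const_smul w
  rw [expCoeff_freeSolution hn hw g hi, expCoeff_congr _ hg, expCoeff_sub _ (hY.1 n le_rfl) h0,
    expCoeff_smul, expCoeff_of_isDerivSeq hY hYt hi, expCoeff_of_isDerivSeq hY hYt le_rfl,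
    ← sub_smul, smul_smul, freeMultiplier, div_mul_cancel₀ _ (sub_ne_zero.2 (hw k))]

/-- `R₀` is the resolvent of the free operator at `w`, and `B` the perturbation times `R₀`. -/
structure IsFreeResolvent (n : ℕ) (P : ℕ → ℝ → Matrix (Fin m) (Fin m) ℂ) (t w : ℂ)
    (R₀ B : L2Vec m →L[ℂ] L2Vec m) : Prop where
  ne : ∀ k, (Complex.I * blochFreq t k) ^ n ≠ w
  resolvent : ∀ f, R₀ f =ᵐ[unitMeasure] freeSolution n t w f 0
  perturbation : ∀ f, B f =ᵐ[unitMeasure] fun x =>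
    ∑ ν ∈ Finset.Icc 2 n, Matrix.toEuclideanLin (P ν x) (freeSolution n t w f (n - ν) x)
  norm_le : ‖B‖ ≤ 1 / 2

theorem norm_smul_le_half {B : L2Vec m →L[ℂ] L2Vec m} (hB : ‖B‖ ≤ 1 / 2) {z : ℝ}
    (hz : z ∈ Icc (0 : ℝ) 1) : ‖(z : ℂ) • B‖ ≤ 1 / 2 := by
  rw [norm_smul, Complex.norm_real, Real.norm_of_nonneg hz.1]
  nlinarith [hz.1, hz.2, norm_nonneg B]

theorem isUnit_one_add {F : Type*} [NormedAddCommGroup F] [NormedSpace ℂ F] [CompleteSpace F]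
    {B : F →L[ℂ] F} (hB : ‖B‖ ≤ 1 / 2) : IsUnit (1 + B) := by
  have := isUnit_one_sub_of_norm_lt_one (x := -B) (by rw [norm_neg]; linarith)
  rwa [sub_neg_eq_add] at this

theorem norm_inverse_one_add_le {F : Type*} [NormedAddCommGroup F] [NormedSpace ℂ F]
    [CompleteSpace F] {B : F →L[ℂ] F} (hB : ‖B‖ ≤ 1 / 2) : ‖Ring.inverse (1 + B)‖ ≤ 2 := by
  have h := Ring.mul_inverse_cancel _ (isUnit_one_add hB)
  have h1 : Ring.inverse (1 + B) = 1 - B * Ring.inverse (1 + B) := by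
    rw [add_mul, one_mul] at h
    exact eq_sub_of_add_eq h
  have h2 : ‖Ring.inverse (1 + B)‖ ≤ 1 + 1 / 2 * ‖Ring.inverse (1 + B)‖ := by
    nth_rewrite 1 [h1]
    refine (norm_sub_le _ _).trans (add_le_add ContinuousLinearMap.norm_id_le ?_)
    exact (norm_mul_le _ _).trans (by gcongr)
  linarith

/-- The resolvent of the operator with coefficients `z P_ν`. -/
def perturbedResolvent (R₀ B : L2Vec m →L[ℂ] L2Vec m) (z : ℝ) : L2Vec m →L[ℂ] L2Vec m :=
  R₀ * Ring.inverse (1 + (z : ℂ) • B)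

theorem perturbedResolvent_zero (R₀ B : L2Vec m →L[ℂ] L2Vec m) :
    perturbedResolvent R₀ B 0 = R₀ := by
  simp [perturbedResolvent]

theorem norm_perturbedResolvent_le {R₀ B : L2Vec m →L[ℂ] L2Vec m} (hB : ‖B‖ ≤ 1 / 2) {z : ℝ}
    (hz : z ∈ Icc (0 : ℝ) 1) : ‖perturbedResolvent R₀ B z‖ ≤ 2 * ‖R₀‖ := by
  rw [mul_comm]
  exact (norm_mul_le _ _).trans (mul_le_mul_of_nonneg_left
    (norm_inverse_one_add_le (norm_smul_le_half hB hz)) (norm_nonneg _))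

theorem norm_perturbedResolvent_sub_le {R₀ B : L2Vec m →L[ℂ] L2Vec m} (hB : ‖B‖ ≤ 1 / 2) {z z' : ℝ}
    (hz : z ∈ Icc (0 : ℝ) 1) (hz' : z' ∈ Icc (0 : ℝ) 1) :
    ‖perturbedResolvent R₀ B z - perturbedResolvent R₀ B z'‖ ≤ 2 * ‖R₀‖ * |z - z'| := by
  have hu := isUnit_one_add (norm_smul_le_half hB hz)
  have hu' := isUnit_one_add (norm_smul_le_half hB hz')
  have h1 := norm_inverse_one_add_le (norm_smul_le_half hB hz)
  have h2 := norm_inverse_one_add_le (norm_smul_le_half hB hz')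
  -- The resolvent identity for `(1 + zB)⁻¹`. Both inverses have norm at most `2` and `‖B‖ ≤ 1/2`,
  -- which yields the constant `2`.
  have key : perturbedResolvent R₀ B z - perturbedResolvent R₀ B z' =
      R₀ * (Ring.inverse (1 + (z : ℂ) • B) * ((((z' - z : ℝ) : ℂ) • B) *
        Ring.inverse (1 + (z' : ℂ) • B))) := by
    rw [perturbedResolvent, perturbedResolvent, ← mul_sub]
    congr 1
    have h3 : (((z' - z : ℝ) : ℂ) • B) = (1 + (z' : ℂ) • B) - (1 + (z : ℂ) • B) := by
      push_cast; rw [sub_smul]; abel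
    rw [h3, sub_mul, Ring.mul_inverse_cancel _ hu', mul_sub, mul_one, ← mul_assoc,
      Ring.inverse_mul_cancel _ hu, one_mul]
  have h4 : ‖(((z' - z : ℝ) : ℂ) • B)‖ ≤ |z - z'| * (1 / 2) := by
    rw [norm_smul, Complex.norm_real, Real.norm_eq_abs, abs_sub_comm]
    gcongr
  rw [key]
  calc _ ≤ ‖R₀‖ * (‖Ring.inverse (1 + (z : ℂ) • B)‖ * (‖(((z' - z : ℝ) : ℂ) • B)‖ *
        ‖Ring.inverse (1 + (z' : ℂ) • B)‖)) :=
      (norm_mul_le _ _).trans (mul_le_mul_of_nonneg_left ((norm_mul_le _ _).trans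
        (mul_le_mul_of_nonneg_left (norm_mul_le _ _) (norm_nonneg _))) (norm_nonneg _))
    _ ≤ ‖R₀‖ * (2 * ((|z - z'| * (1 / 2)) * 2)) := by gcongr
    _ = _ := by ring

/-- Writing elements of the domain as `R₀ g`, one has `(L_{t,z} - w) R₀ g = (1 + zB) g`, and `1 +
zB` is invertible by the Neumann series. -/
theorem IsFreeResolvent.isResolventAt (hn : 2 ≤ n) {P : ℕ → ℝ → Matrix (Fin m) (Fin m) ℂ}
    {R₀ B : L2Vec m →L[ℂ] L2Vec m} (h : IsFreeResolvent n P t w R₀ B) {z : ℝ}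
    (hz : z ∈ Icc (0 : ℝ) 1) :
    IsResolventAt (blochOperator n (fun ν x => (z : ℂ) • P ν x) t) w
      (perturbedResolvent R₀ B z) := by
  have hn0 : 0 < n := by omega
  have hu := isUnit_one_add (norm_smul_le_half h.norm_le hz)
  constructor
  · intro f
    set g := Ring.inverse (1 + (z : ℂ) • B) f with hg
    have hgf : g + (z : ℂ) • B g = f :=
      congrArg (fun A : L2Vec m →L[ℂ] L2Vec m => A f) (Ring.mul_inverse_cancel _ hu)
    rw [blochOperator_graph]
    change (R₀ g, w • R₀ g + f) ∈ _
    refine ⟨freeSolution n t w g, isDerivSeq_freeSolution hn0 h.ne g,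
      quasiPeriodic_freeSolution g, h.resolvent g, ?_⟩
    rw [← hgf]
    filter_upwards [Lp.coeFn_add (w • R₀ g) (g + (z : ℂ) • B g), Lp.coeFn_smul w (R₀ g),
      Lp.coeFn_add g ((z : ℂ) • B g), Lp.coeFn_smul (z : ℂ) (B g), h.resolvent g,
      h.perturbation g] with x h1 h2 h3 h4 h5 h6
    simp only [h1, Pi.add_apply, h2, h3, Pi.smul_apply, h4, h5, h6, diffExpr,
      freeSolution_self _ hn0, map_smul, LinearMap.smul_apply, Finset.smul_sum]
    abel
  · intro y
    have hy : ((y : L2Vec m), blochOperator n (fun ν x => (z : ℂ) • P ν x) t y) ∈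
        blochGraph n (fun ν x => (z : ℂ) • P ν x) t := by
      rw [← blochOperator_graph]
      exact LinearPMap.mem_graph _ y
    obtain ⟨Y, hY, hYt, hY1, hY2⟩ := hy
    have hmem : MemLp (fun x => Y n x - w • Y 0 x) 2 unitMeasure :=
      (hY.1 n le_rfl).sub ((hY.1 0 hn0.le).const_smul w)
    set g : L2Vec m := hmem.toLp with hg
    have hgae : g =ᵐ[unitMeasure] fun x => Y n x - w • Y 0 x := hmem.coeFn_toLp
    have hsol := fun i hi => ae_eq_freeSolution hn0 h.ne hY hYt hgae (i := i) hi
    have hR : R₀ g = y := by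
      refine Lp.ext ?_
      filter_upwards [h.resolvent g, hsol 0 hn0.le, hY1] with x h1 h2 h3
      rw [h1, ← h2, h3]
    have hall : ∀ᵐ x ∂unitMeasure, ∀ i : ℕ, i ≤ n → Y i x = freeSolution n t w g i x := by
      rw [ae_all_iff]
      intro i
      by_cases hi : i ≤ n
      · filter_upwards [hsol i hi] with x hx _ using hx
      · exact ae_of_all _ fun x h => absurd h hi
    have hT : blochOperator n (fun ν x => (z : ℂ) • P ν x) t y - w • (y : L2Vec m) =
        (1 + (z : ℂ) • B) g := by
      change _ = g + (z : ℂ) • B g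
      rw [sub_eq_iff_eq_add]
      refine Lp.ext ?_
      filter_upwards [hY1, hY2, hgae, hall, Lp.coeFn_add (g + (z : ℂ) • B g) (w • (y : L2Vec m)),
        Lp.coeFn_smul w (y : L2Vec m), Lp.coeFn_add g ((z : ℂ) • B g),
        Lp.coeFn_smul (z : ℂ) (B g), h.perturbation g] with x h1 h2 h3 h4 h5 h6 h7 h8 h9
      simp only [h2, h5, h6, h7, h8, h9, h1, h3, Pi.add_apply, Pi.smul_apply, diffExpr, map_smul,
        LinearMap.smul_apply, Finset.smul_sum]
      have h10 : ∀ ν, freeSolution n t w g (n - ν) x = Y (n - ν) x := fun ν =>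
        (h4 _ (Nat.sub_le _ _)).symm
      simp only [h10]
      abel
    rw [hT, perturbedResolvent, mul_apply_eq_comp]
    have h1 : Ring.inverse (1 + (z : ℂ) • B) ((1 + (z : ℂ) • B) g) = g :=
      congrArg (fun A : L2Vec m →L[ℂ] L2Vec m => A g) (Ring.inverse_mul_cancel _ hu)
    rw [h1, hR]

end Resolvent

/-! ### Counting the eigenvalues of the Bloch operator in a disk -/

section Count

variable {m n : ℕ} {t w : ℂ}

/-- The norm bound for the potential `P`. -/
def potentialNorm (n : ℕ) (P : ℕ → ℝ → Matrix (Fin m) (Fin m) ℂ) : ℝ :=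
  ∑ ν ∈ Finset.Icc 2 n, (eLpNorm (fun x => entrySum (P ν x)) 2 unitMeasure).toReal

/-- `w` is not an eigenvalue of the free operator, and the multipliers of `D^i (D^n - w)⁻¹`,
`i ≤ n - 2`, have `ℓ²` norm at most `δ`. -/
def FreeBound (n : ℕ) (t : ℂ) (δ : ℝ) (w : ℂ) : Prop :=
  (∀ k, (Complex.I * blochFreq t k) ^ n ≠ w) ∧
    ∀ i, i + 2 ≤ n → ∑' k, ‖freeMultiplier n t w i k‖ ^ 2 ≤ δ ^ 2

/-- `B` is a sum of operators from `exists_mul_expSeries`. Since `ν ≥ 2`, only derivatives of order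
at most `n - 2` enter, those that `FreeBound` controls; the factor `e²` absorbs `exp |t.im| ^ 2`. -/
theorem exists_isFreeResolvent (hn : 2 ≤ n) {P : ℕ → ℝ → Matrix (Fin m) (Fin m) ℂ}
    (hP : ∀ ν ∈ Finset.Icc 2 n, ∀ i j, MemLp (fun x => P ν x i j) 2 unitMeasure)
    (ht : |t.im| ≤ 1) {δ : ℝ} (hδ : 0 ≤ δ)
    (hδP : Real.exp 1 ^ 2 * δ * potentialNorm n P ≤ 1 / 2) (hw : FreeBound n t δ w) :
    ∃ R₀ B : L2Vec m →L[ℂ] L2Vec m, IsFreeResolvent n P t w R₀ B ∧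
      ‖R₀‖ ≤ Real.exp 1 ^ 2 * δ *
        (eLpNorm (fun _ => entrySum (1 : Matrix (Fin m) (Fin m) ℂ)) 2 unitMeasure).toReal := by
  have hsq : ∀ i, i + 2 ≤ n →
      Real.exp |t.im| ^ 2 * √(∑' k, ‖freeMultiplier n t w i k‖ ^ 2) ≤ Real.exp 1 ^ 2 * δ := by
    intro i hi
    have h1 : √(∑' k, ‖freeMultiplier n t w i k‖ ^ 2) ≤ δ := Real.sqrt_le_iff.2 ⟨hδ, hw.2 i hi⟩
    gcongr
  -- The identity matrix as coefficient yields the free resolvent itself.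
  obtain ⟨R₀, hR₀, hR₀n⟩ := exists_mul_expSeries
    (A := fun _ => (1 : Matrix (Fin m) (Fin m) ℂ)) (fun i j => memLp_const _)
    (summable_sq_freeMultiplier t w (i := 0) (by omega : 0 < n))
  have hB : ∀ ν ∈ Finset.Icc 2 n, ∃ B : L2Vec m →L[ℂ] L2Vec m,
      (∀ f : L2Vec m, B f =ᵐ[unitMeasure] fun x =>
        Matrix.toEuclideanLin (P ν x) (freeSolution n t w f (n - ν) x)) ∧
      ‖B‖ ≤ Real.exp 1 ^ 2 * δ *
        (eLpNorm (fun x => entrySum (P ν x)) 2 unitMeasure).toReal := by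
    intro ν hν
    have hν2 := (Finset.mem_Icc.1 hν).1
    have hlt : n - ν < n := by omega
    obtain ⟨B, h1, h2⟩ := exists_mul_expSeries (hP ν hν) (summable_sq_freeMultiplier t w hlt)
    refine ⟨B, fun f => ?_, h2.trans (mul_le_mul_of_nonneg_right
      (hsq _ (by have := (Finset.mem_Icc.1 hν).2; omega)) ENNReal.toReal_nonneg)⟩
    rw [freeSolution_of_lt _ hlt]
    exact h1 f
  choose! B hB1 hB2 using hB
  refine ⟨R₀, ∑ ν ∈ Finset.Icc 2 n, B ν, ⟨hw.1, fun f => ?_, fun f => ?_, ?_⟩,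
    hR₀n.trans (mul_le_mul_of_nonneg_right (hsq 0 (by omega)) ENNReal.toReal_nonneg)⟩
  · filter_upwards [hR₀ f] with x hx
    rw [hx, freeSolution_of_lt _ (by omega)]
    simp [Matrix.toLpLin_one]
  · have h1 : ∀ᵐ x ∂unitMeasure, ∀ ν ∈ Finset.Icc 2 n, B ν f x =
        Matrix.toEuclideanLin (P ν x) (freeSolution n t w f (n - ν) x) := by
      rw [Filter.eventually_all_finset]
      exact fun ν hν => hB1 ν hν f
    have h2 : (∑ ν ∈ Finset.Icc 2 n, B ν) f = ∑ ν ∈ Finset.Icc 2 n, B ν f := by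
      simp
    rw [h2]
    filter_upwards [h1, Lp.coeFn_fun_finsetSum (p := 2) (μ := unitMeasure) (Finset.Icc 2 n)
      (fun ν => B ν f)] with x h3 h4
    rw [h4]
    exact Finset.sum_congr rfl h3
  · refine (norm_sum_le _ _).trans ((Finset.sum_le_sum hB2).trans ?_)
    rw [← Finset.mul_sum]
    exact hδP

/-- The Fourier coefficient as a continuous functional on `L₂`. -/
theorem exists_expCoeff_clm (κ : ℂ) : ∃ φ : L2Vec m →L[ℂ] EuclideanSpace ℂ (Fin m),
    ∀ f : L2Vec m, φ f = expCoeff κ f := by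
  let φ₀ : L2Vec m →ₗ[ℂ] EuclideanSpace ℂ (Fin m) :=
    { toFun := fun f => expCoeff κ f
      map_add' := fun f g => (expCoeff_congr κ (Lp.coeFn_add f g)).trans
        (expCoeff_add κ (Lp.memLp f) (Lp.memLp g))
      map_smul' := fun c f => (expCoeff_congr κ (Lp.coeFn_smul c f)).trans (expCoeff_smul κ c f) }
  refine ⟨φ₀.mkContinuous (Real.exp |κ.im|) fun f => ?_, fun f => rfl⟩
  have hsum := summable_sq_norm_expCoeff κ f
  have h1 := hsum.le_tsum 0 fun _ _ => by positivity
  have h2 := h1.trans (tsum_sq_norm_expCoeff_le κ f)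
  -- Any `κ` is the frequency of index `0` for the parameter `t = κ`, so a single term of the
  -- Parseval sum bounds the functional.
  have h3 : blochFreq κ 0 = κ := by simp [blochFreq]
  rw [h3] at h2
  exact abs_le_of_sq_le_sq' h2 (by positivity) |>.2

theorem IsFreeResolvent.expCoeff_apply (hn : 0 < n) {P : ℕ → ℝ → Matrix (Fin m) (Fin m) ℂ}
    {R₀ B : L2Vec m →L[ℂ] L2Vec m} (h : IsFreeResolvent n P t w R₀ B) (f : L2Vec m) (k : ℤ) :
    expCoeff (blochFreq t k) (R₀ f) =
      ((Complex.I * blochFreq t k) ^ n - w)⁻¹ • expCoeff (blochFreq t k) f := by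
  rw [expCoeff_congr _ (h.resolvent f), expCoeff_freeSolution hn h.ne f (Nat.zero_le _),
    freeMultiplier, pow_zero, one_div]

theorem L2Vec_eq_of_expCoeff_eq (t : ℂ) {f g : L2Vec m}
    (h : ∀ k, expCoeff (blochFreq t k) f = expCoeff (blochFreq t k) g) : f = g :=
  Lp.ext (ae_eq_of_expCoeff_eq t (Lp.memLp f) (Lp.memLp g) h)

theorem exists_expCoeff_eq (t : ℂ) (s : Finset ℤ) (v : ℤ → EuclideanSpace ℂ (Fin m)) :
    ∃ f : L2Vec m, ∀ k, expCoeff (blochFreq t k) f = if k ∈ s then v k else 0 := by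
  classical
  induction s using Finset.induction_on with
  | empty =>
    refine ⟨0, fun k => ?_⟩
    rw [expCoeff_congr _ (Lp.coeFn_zero _ _ _)]
    simp [expCoeff]
  | insert l s hl ih =>
    obtain ⟨f, hf⟩ := ih
    have hmem : MemLp (fun x => expI (blochFreq t l) x • v l) 2 unitMeasure :=
      memLp_of_continuousOn (by fun_prop)
    refine ⟨hmem.toLp + f, fun k => ?_⟩
    rw [expCoeff_congr _ (Lp.coeFn_add _ _)]
    refine (expCoeff_add _ (Lp.memLp _) (Lp.memLp _)).trans ?_
    rw [expCoeff_congr _ hmem.coeFn_toLp, expCoeff_expI_smul, hf]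
    by_cases hkl : l = k
    · subst hkl; simp [hl]
    · have : k ≠ l := fun h => hkl h.symm
      simp [hkl, this]

/-- A map that restricts the Fourier coefficients to the finite set `s` has rank `|s| m`. -/
theorem finrank_range_of_expCoeff (t : ℂ) {Q : L2Vec m →L[ℂ] L2Vec m} (s : Finset ℤ)
    (hQ : ∀ f k, expCoeff (blochFreq t k) (Q f) =
      if k ∈ s then expCoeff (blochFreq t k) f else 0) :
    FiniteDimensional ℂ Q.range ∧ Module.finrank ℂ Q.range = s.card * m := by
  choose φ hφ using fun k : ℤ => exists_expCoeff_clm (m := m) (blochFreq t k)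
  let J : Q.range →ₗ[ℂ] (s → EuclideanSpace ℂ (Fin m)) :=
    LinearMap.pi fun k => (φ k : L2Vec m →ₗ[ℂ] _) ∘ₗ Q.range.subtype
  have hJ : ∀ (f : Q.range) (k : s), J f k = expCoeff (blochFreq t k) (f : L2Vec m) :=
    fun f k => hφ k f
  have hinj : Function.Injective J := by
    rintro ⟨_, f, rfl⟩ ⟨_, g, rfl⟩ hfg
    refine Subtype.ext (L2Vec_eq_of_expCoeff_eq t fun k => ?_)
    by_cases hk : k ∈ s
    · have := congrFun hfg ⟨k, hk⟩
      rwa [hJ, hJ] at this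
    · refine (hQ f k).trans ((hQ g k).trans ?_).symm
      simp [hk]
  have hsurj : Function.Surjective J := by
    intro v
    obtain ⟨f, hf⟩ := exists_expCoeff_eq t s fun k => if hk : k ∈ s then v ⟨k, hk⟩ else 0
    refine ⟨⟨Q f, f, rfl⟩, funext fun k => ?_⟩
    rw [hJ]
    refine (hQ f k).trans ?_
    rw [hf]
    simp
  have e := LinearEquiv.ofBijective J ⟨hinj, hsurj⟩
  refine ⟨FiniteDimensional.of_injective J hinj, ?_⟩
  rw [e.finrank_eq, Module.finrank_pi_fintype]
  simp

/-- Deformation to `z = 0`. There the resolvent multiplies the `k`-th coefficient by `((i(2πk+t))^n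
- w)⁻¹`, so the Riesz projection keeps the coefficients in `s` and removes the others. -/
theorem hasEigenvalueCount_blochOperator (hn : 2 ≤ n) {P : ℕ → ℝ → Matrix (Fin m) (Fin m) ℂ}
    (hP : ∀ ν ∈ Finset.Icc 2 n, ∀ i j, MemLp (fun x => P ν x i j) 2 unitMeasure)
    (ht : |t.im| ≤ 1) {δ : ℝ} (hδ : 0 ≤ δ)
    (hδP : Real.exp 1 ^ 2 * δ * potentialNorm n P ≤ 1 / 2) {c : ℂ} {r₁ r₂ : ℝ} (h0 : 0 < r₁)
    (h12 : r₁ < r₂) (hw : ∀ w, r₁ ≤ ‖w - c‖ → ‖w - c‖ ≤ r₂ → FreeBound n t δ w) (s : Finset ℤ)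
    (hs : ∀ k, k ∈ s ↔ ‖(Complex.I * blochFreq t k) ^ n - c‖ < r₂) :
    HasEigenvalueCount (blochOperator n P t) (Metric.ball c r₂) (s.card * m) := by
  have h02 := h0.trans h12
  have hn0 : 0 < n := by omega
  have hex := fun w (h : r₁ ≤ ‖w - c‖ ∧ ‖w - c‖ ≤ r₂) =>
    exists_isFreeResolvent hn hP ht hδ hδP (hw w h.1 h.2)
  choose! R₀ B hRB hR₀ using hex
  set C := Real.exp 1 ^ 2 * δ *
        (eLpNorm (fun _ => entrySum (1 : Matrix (Fin m) (Fin m) ℂ)) 2 unitMeasure).toReal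
  have hsphere : ∀ w ∈ Metric.sphere c r₂, r₁ ≤ ‖w - c‖ ∧ ‖w - c‖ ≤ r₂ := fun w h => by
    rw [mem_sphere_iff_norm] at h
    exact ⟨h ▸ h12.le, h.le⟩
  have hfam : ∀ z ∈ Icc (0 : ℝ) 1,
      IsResolventFamily (blochOperator n (fun ν x => (z : ℂ) • P ν x) t)
        (fun w => perturbedResolvent (R₀ w) (B w) z) c r₁ r₂ := fun z hz =>
    ⟨fun w h1 h2 => (hRB w ⟨h1, h2⟩).isResolventAt hn hz, 2 * C, fun w h1 h2 =>
      (norm_perturbedResolvent_le (hRB w ⟨h1, h2⟩).norm_le hz).trans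
        (mul_le_mul_of_nonneg_left (hR₀ w ⟨h1, h2⟩) (by norm_num))⟩
  have hQ : ∀ f k, expCoeff (blochFreq t k)
      (rieszProjection (fun w => perturbedResolvent (R₀ w) (B w) 0) c r₂ f) =
        if k ∈ s then expCoeff (blochFreq t k) f else 0 := by
    intro f k
    obtain ⟨φ, hφ⟩ := exists_expCoeff_clm (m := m) (blochFreq t k)
    have hci : CircleIntegrable (fun w => perturbedResolvent (R₀ w) (B w) 0 f) c r₂ := by
      have h1 := ((hfam 0 (by simp)).continuousOn.mono hsphere)
      exact (h1.clm_apply continuousOn_const).circleIntegrable h02.le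
    rw [(hfam 0 (by simp)).rieszProjection_apply h0 h12.le, ← hφ, map_neg, map_smul]
    have h1 : φ (∮ w in C(c, r₂), perturbedResolvent (R₀ w) (B w) 0 f) =
        ∮ w in C(c, r₂), ((Complex.I * blochFreq t k) ^ n - w)⁻¹ •
          expCoeff (blochFreq t k) f := by
      refine (φ.intervalIntegral_comp_comm hci.out).symm.trans ?_
      refine Eq.trans ?_ (circleIntegral.integral_congr h02.le
        (f := fun w => φ (perturbedResolvent (R₀ w) (B w) 0 f)) fun w hw => ?_)
      · simp only [map_smul]
        rfl
      · simp only
        rw [hφ, perturbedResolvent_zero]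
        exact (hRB w (hsphere w hw)).expCoeff_apply hn0 f k
    rw [h1]
    by_cases hk : k ∈ s
    · rw [if_pos hk]
      exact (circleIntegral_inv_smul h02 _).1 ((hs k).1 hk)
    · rw [if_neg hk]
      refine (circleIntegral_inv_smul h02 _).2 (lt_of_le_of_ne (not_lt.1 fun h => hk ((hs k).2 h))
        fun h => ?_)
      exact (hw _ (h ▸ h12.le) h.ge).1 k rfl
  obtain ⟨hfin, hrank⟩ := finrank_range_of_expCoeff t s hQ
  have hcount := hasEigenvalueCount_of_homotopy h0 h12 hfam (C := 2 * C) fun z hz z' hz' w hw' =>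
    (norm_perturbedResolvent_sub_le (hRB w (hsphere w hw')).norm_le hz hz').trans
      (mul_le_mul_of_nonneg_right (mul_le_mul_of_nonneg_left (hR₀ w (hsphere w hw')) (by norm_num))
        (abs_nonneg _))
  rw [hrank] at hcount
  simpa using hcount

theorem not_isEigenvalue_blochOperator (hn : 2 ≤ n) {P : ℕ → ℝ → Matrix (Fin m) (Fin m) ℂ}
    (hP : ∀ ν ∈ Finset.Icc 2 n, ∀ i j, MemLp (fun x => P ν x i j) 2 unitMeasure)
    (ht : |t.im| ≤ 1) {δ : ℝ} (hδ : 0 ≤ δ)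
    (hδP : Real.exp 1 ^ 2 * δ * potentialNorm n P ≤ 1 / 2) (hw : FreeBound n t δ w) {z : ℝ}
    (hz : z ∈ Icc (0 : ℝ) 1) :
    ¬ IsEigenvalue (blochOperator n (fun ν x => (z : ℂ) • P ν x) t) w := by
  obtain ⟨R₀, B, h, -⟩ := exists_isFreeResolvent hn hP ht hδ hδP hw
  exact (h.isResolventAt hn hz).not_isEigenvalue

theorem SquareIntegrableDeriv.memLp {s : ℕ} {f : ℝ → ℂ} (h : SquareIntegrableDeriv s f) :
    MemLp f 2 unitMeasure := by
  induction s generalizing f with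
  | zero => exact h
  | succ s ih =>
    obtain ⟨g, c, hg, hfg⟩ := h
    have hint : IntervalIntegrable g volume 0 1 := by
      rw [intervalIntegrable_iff_integrableOn_Icc_of_le zero_le_one]
      exact (ih hg).integrable (by norm_num)
    have hcont : ContinuousOn (fun x => c + ∫ u in (0 : ℝ)..x, g u) (Icc 0 1) := by
      have := intervalIntegral.continuousOn_primitive_interval' hint (a := 0) (by simp)
      rw [uIcc_of_le zero_le_one] at this
      exact continuousOn_const.add this
    obtain ⟨C, hC⟩ := isCompact_Icc.exists_bound_of_continuousOn hcont
    refine MemLp.ae_eq (Filter.EventuallyEq.symm hfg)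
      (MemLp.of_bound (hcont.aestronglyMeasurable measurableSet_Icc) C ?_)
    filter_upwards [ae_restrict_mem measurableSet_Icc] with x hx using hC x hx

end Count

/-! ### Circles as simple closed curves -/

section Circle

theorem isSimpleClosedCurve_sphere (c : ℂ) {R : ℝ} (hR : 0 < R) :
    IsSimpleClosedCurve (Metric.sphere c R) := by
  have hpi := Real.two_pi_pos
  refine ⟨fun x => circleMap c R (2 * Real.pi * x), ?_, ?_, ?_, ?_⟩
  · exact (contDiff_circleMap c R).comp (contDiff_const.mul contDiff_id)
  · intro x
    simp only
    rw [mul_add, mul_one, periodic_circleMap c R]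
  · intro x hx y hy hxy
    have h := injOn_circleMap_of_abs_sub_le' (a := 0) (b := 2 * Real.pi) (c := c) hR.ne'
      (by linarith) ⟨by nlinarith [hx.1], by nlinarith [hx.2]⟩
      ⟨by nlinarith [hy.1], by nlinarith [hy.2]⟩ hxy
    exact mul_left_cancel₀ hpi.ne' h
  · have hsurj : Function.Surjective fun x : ℝ => 2 * Real.pi * x := fun y =>
      ⟨y / (2 * Real.pi), by field_simp⟩
    have h1 : range (fun x => circleMap c R (2 * Real.pi * x)) = range (circleMap c R) :=
      hsurj.range_comp (circleMap c R)
    rw [h1, range_circleMap, abs_of_pos hR]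

theorem inside_sphere_zero {R : ℝ} (hR : 0 < R) :
    inside (Metric.sphere (0 : ℂ) R) = Metric.ball 0 R := by
  ext w
  constructor
  · rintro ⟨hw, hb⟩
    rw [mem_sphere_zero_iff_norm] at hw
    rw [mem_ball_zero_iff]
    by_contra hlt
    have hgt : R < ‖w‖ := lt_of_le_of_ne (not_lt.1 hlt) (Ne.symm hw)
    -- A point outside the circle is joined to infinity by its radial ray, so its component is
    -- unbounded.
    have hray : (fun s : ℝ => (s : ℂ) * w) '' Ici 1 ⊆
        connectedComponentIn (Metric.sphere (0 : ℂ) R)ᶜ w := by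
      refine IsPreconnected.subset_connectedComponentIn ?_ ⟨1, by simp, by simp⟩ ?_
      · exact isPreconnected_Ici.image _ (by fun_prop)
      · rintro _ ⟨s, hs, rfl⟩
        have hs1 : (1 : ℝ) ≤ s := hs
        rw [mem_compl_iff, mem_sphere_zero_iff_norm, norm_mul, Complex.norm_real,
          Real.norm_of_nonneg (by linarith)]
        nlinarith
    obtain ⟨M, hM⟩ := (hb.subset hray).exists_norm_le
    have hM1 := hM _ ⟨|M| / R + 1, by simp; positivity, rfl⟩
    rw [norm_mul, Complex.norm_real, Real.norm_of_nonneg (by positivity)] at hM1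
    have h1 : (|M| / R + 1) * R = |M| + R := by field_simp
    have h2 : (|M| / R + 1) * R ≤ (|M| / R + 1) * ‖w‖ := by gcongr
    linarith [le_abs_self M]
  · intro hw
    have hw' := mem_ball_zero_iff.1 hw
    have hns : w ∈ (Metric.sphere (0 : ℂ) R)ᶜ := by
      rw [mem_compl_iff, mem_sphere_zero_iff_norm]; exact hw'.ne
    refine ⟨hns, Metric.isBounded_ball.subset (IsPreconnected.subset_left_of_subset_union
      (u := Metric.ball (0 : ℂ) R) (v := (Metric.closedBall (0 : ℂ) R)ᶜ) Metric.isOpen_ball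
      Metric.isClosed_closedBall.isOpen_compl ?_ ?_ ?_ isPreconnected_connectedComponentIn)⟩
    · exact disjoint_compl_right_iff_subset.2 Metric.ball_subset_closedBall
    · intro v hv
      have := connectedComponentIn_subset _ _ hv
      rw [mem_compl_iff, mem_sphere_zero_iff_norm] at this
      rcases lt_or_gt_of_ne this with h | h
      · exact Or.inl (mem_ball_zero_iff.2 h)
      · exact Or.inr (by rw [mem_compl_iff, mem_closedBall_zero_iff]; exact not_le.2 h)
    · exact ⟨w, mem_connectedComponentIn hns, hw⟩

end Circle

/-! ### Localization of the free eigenvalues -/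

section Localization

variable {n : ℕ} {a : ℝ} {p : ℤ → ℕ}

/-- The center of the `j`-th disk. -/
def diskCenter (n : ℕ) (a : ℝ) (j : ℕ) : ℂ := ((2 * Real.pi * j + a : ℝ) * Complex.I) ^ n

theorem norm_pow_sub_pow_le (x y : ℂ) (n : ℕ) :
    ‖x ^ n - y ^ n‖ ≤ n * max ‖x‖ ‖y‖ ^ (n - 1) * ‖x - y‖ := by
  rw [← (Commute.all x y).geom_sum₂_mul n, norm_mul]
  gcongr
  refine (norm_sum_le _ _).trans ?_
  have : ∀ i ∈ Finset.range n, ‖x ^ i * y ^ (n - 1 - i)‖ ≤ max ‖x‖ ‖y‖ ^ (n - 1) := by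
    intro i hi
    have hi' := Finset.mem_range.1 hi
    rw [norm_mul, norm_pow, norm_pow]
    calc ‖x‖ ^ i * ‖y‖ ^ (n - 1 - i) ≤ max ‖x‖ ‖y‖ ^ i * max ‖x‖ ‖y‖ ^ (n - 1 - i) := by
          gcongr
          · exact le_max_left _ _
          · exact le_max_right _ _
      _ = _ := by rw [← pow_add]; congr 1; omega
  refine (Finset.sum_le_sum this).trans ?_
  simp

theorem norm_diskCenter_sub (ha : 0 ≤ a) {i j : ℕ} (hij : i ≤ j) :
    ‖diskCenter n a j - diskCenter n a i‖ =
      (2 * Real.pi * j + a) ^ n - (2 * Real.pi * i + a) ^ n := by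
  have hpi := Real.pi_pos
  rw [diskCenter, diskCenter, mul_pow, mul_pow, ← sub_mul, norm_mul, norm_pow, Complex.norm_I,
    one_pow, mul_one, ← Complex.ofReal_pow, ← Complex.ofReal_pow, ← Complex.ofReal_sub,
    Complex.norm_real, Real.norm_of_nonneg]
  have : (2 * Real.pi * i + a) ^ n ≤ (2 * Real.pi * j + a) ^ n := by gcongr
  linarith

theorem norm_diskCenter (ha : 0 ≤ a) (j : ℕ) :
    ‖diskCenter n a j‖ = (2 * Real.pi * j + a) ^ n := by
  have hpi := Real.pi_pos
  rw [diskCenter, norm_pow, norm_mul, Complex.norm_I, mul_one, Complex.norm_real,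
    Real.norm_of_nonneg (by positivity)]

/-- With `x` and `y` the two bases, `x^n - y^n ≥ (x - y) x^{n-1}` and `x - y ≥ 2π > 3`. The factor
`3` leaves room between two disks whose radii are at most `j^{n-1}`. -/
theorem three_mul_pow_le (hn : 2 ≤ n) (ha : 0 ≤ a) {i j : ℕ} (hij : i < j) :
    3 * (j : ℝ) ^ (n - 1) ≤ (2 * Real.pi * j + a) ^ n - (2 * Real.pi * i + a) ^ n := by
  have hpi := Real.pi_gt_three
  have hpi0 := Real.pi_pos
  obtain ⟨l, rfl⟩ : ∃ l, n = l + 1 := ⟨n - 1, by omega⟩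
  rw [Nat.add_sub_cancel]
  set x := 2 * Real.pi * j + a with hx
  set y := 2 * Real.pi * i + a with hy
  have hij' : (i : ℝ) + 1 ≤ j := by exact_mod_cast hij
  have hxy : 3 ≤ x - y := by
    have : x - y = 2 * Real.pi * (j - i) := by rw [hx, hy]; ring
    nlinarith
  have hy0 : 0 ≤ y := by positivity
  have hyx : y ^ l ≤ x ^ l := pow_le_pow_left₀ hy0 (by linarith) l
  have hjx : (j : ℝ) ^ l ≤ x ^ l := by
    refine pow_le_pow_left₀ (by positivity) ?_ l
    have : (0 : ℝ) ≤ j := by positivity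
    nlinarith
  have h1 : 3 * (j : ℝ) ^ l ≤ (x - y) * x ^ l := by gcongr
  calc 3 * (j : ℝ) ^ l ≤ (x - y) * x ^ l := h1
    _ = x ^ (l + 1) - y * x ^ l := by ring
    _ ≤ x ^ (l + 1) - y * y ^ l := by gcongr
    _ = _ := by ring

/-- `Σ_k max(|k|,N)⁻²`. -/
def tailSum (N : ℕ) : ℝ := ∑' k : ℤ, (1 / max |(k : ℝ)| N) ^ 2

theorem tailTerm_le {N : ℕ} (hN : 1 ≤ N) (k : ℤ) :
    (1 / max |(k : ℝ)| N) ^ 2 ≤ (1 / max |(k : ℝ)| 1) ^ 2 := by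
  have : (1 : ℝ) ≤ N := by exact_mod_cast hN
  gcongr

theorem summable_tailTerm (N : ℕ) :
    Summable fun k : ℤ => (1 / max |(k : ℝ)| N) ^ 2 := by
  refine (Real.summable_one_div_int_pow.2 one_lt_two).of_norm_bounded_eventually ?_
  filter_upwards [(finite_singleton (0 : ℤ)).compl_mem_cofinite] with k hk
  have hk0 : 0 < |(k : ℝ)| := abs_pos.2 (by exact_mod_cast hk)
  rw [Real.norm_of_nonneg (by positivity), div_pow, one_pow, ← sq_abs (k : ℝ)]
  gcongr
  exact le_max_left _ _

theorem tendsto_tailSum : Tendsto tailSum atTop (𝓝 0) := by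
  have h := tendsto_tsum_of_dominated_convergence (𝓕 := atTop)
    (f := fun (N : ℕ) (k : ℤ) => (1 / max |(k : ℝ)| N) ^ 2) (g := fun _ => (0 : ℝ))
    (bound := fun k : ℤ => (1 / max |(k : ℝ)| 1) ^ 2)
    (by simpa using summable_tailTerm 1) (fun k => ?_) ?_
  · rw [tsum_zero] at h
    exact h
  · have h1 : Tendsto (fun N : ℕ => max |(k : ℝ)| N) atTop atTop :=
      tendsto_atTop_mono (fun N => le_max_right _ _) tendsto_natCast_atTop_atTop
    have h2 := (tendsto_const_nhds (x := (1 : ℝ))).div_atTop h1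
    simpa using h2.pow 2
  · filter_upwards [eventually_ge_atTop 1] with N hN k
    rw [Real.norm_of_nonneg (by positivity)]
    exact tailTerm_le hN k

/-- `p` enumerates the disks: `|2πk + a| = 2π p(k) + a`. -/
def IsDiskIndex (a : ℝ) (p : ℤ → ℕ) : Prop :=
  ∀ k : ℤ, |2 * Real.pi * k + a| = 2 * Real.pi * p k + a

/-- The evenness of `n` enters here: the power forgets the sign of `2πk + a`. -/
theorem IsDiskIndex.diskCenter_eq (hp : IsDiskIndex a p) (hn : Even n) (k : ℤ) :
    diskCenter n a (p k) = (Complex.I * ((2 * Real.pi * k + a : ℝ) : ℂ)) ^ n := by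
  rw [diskCenter, ← hp, mul_pow, mul_pow, mul_comm, ← Complex.ofReal_pow, ← Complex.ofReal_pow,
    hn.pow_abs]

theorem IsDiskIndex.abs_le (hp : IsDiskIndex a p) (ha : 0 ≤ a) (haπ : a ≤ Real.pi) (k : ℤ) :
    |(k : ℝ)| ≤ p k + 1 := by
  have h1 := hp k
  have hpi := Real.pi_pos
  have h2 := abs_sub_abs_le_abs_sub (2 * Real.pi * k : ℝ) (-a)
  rw [sub_neg_eq_add, h1, abs_neg, abs_of_nonneg ha, abs_mul, abs_of_pos (by positivity)] at h2
  have h3 : 2 * Real.pi * |(k : ℝ)| ≤ 2 * Real.pi * (p k + 1) := by linarith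
  exact le_of_mul_le_mul_left h3 (by positivity)

/-- The free eigenvalues lie well inside the disks, and outside slightly smaller disks the free
resolvent is uniformly small. -/
theorem exists_freeBound (hn : 2 ≤ n) (hn_even : Even n) (ha : 0 ≤ a) (haπ : a ≤ Real.pi)
    (hp : IsDiskIndex a p) {h : ℝ} (h_pos : 0 < h) (h_lt : h < 1)
    (h_small : n * (2 * Real.pi) ^ (n - 1) * h < 1) (K : ℝ) :
    ∃ N₀ : ℕ, 0 < N₀ ∧ ∃ θ : ℝ, 0 < θ ∧ θ < 1 ∧ ∀ N ≥ N₀, ∃ δ : ℝ, 0 ≤ δ ∧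
      Real.exp 1 ^ 2 * δ * K ≤ 1 / 2 ∧ ∀ t : ℂ, ‖t - a‖ ≤ h →
        (∀ k, ‖(Complex.I * blochFreq t k) ^ n - diskCenter n a (p k)‖ ≤
          θ * (max (p k) N : ℕ) ^ (n - 1)) ∧
        ∀ w, (∀ j, θ * (max j N : ℕ) ^ (n - 1) ≤ ‖w - diskCenter n a j‖) →
          FreeBound n t δ w := by
  have hpi := Real.pi_pos
  -- `ρ` slightly exceeds `2π`: for `N` large this absorbs the shift `a + h` in `2πj + a + h ≤ ρ
  -- max(j,N)`, while the smallness condition survives.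
  obtain ⟨ρ, hρ, hρ1⟩ : ∃ ρ : ℝ, 2 * Real.pi < ρ ∧ n * ρ ^ (n - 1) * h < 1 := by
    have hc : ContinuousAt (fun ρ : ℝ => n * ρ ^ (n - 1) * h) (2 * Real.pi) := by fun_prop
    have h1 := hc.eventually (gt_mem_nhds h_small)
    obtain ⟨ρ, h2, h3⟩ := ((h1.filter_mono nhdsWithin_le_nhds).and
      (self_mem_nhdsWithin (s := Ioi (2 * Real.pi)))).exists
    exact ⟨ρ, h3, h2⟩
  set θ' := n * ρ ^ (n - 1) * h with hθ'
  have hρ0 : 0 < ρ := by linarith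
  have hθ'0 : 0 < θ' := by positivity
  -- The midpoint of `θ'` and `1`. Free eigenvalues stay within the fraction `θ'` of the radius, so
  -- points beyond the fraction `θ` keep the distance `c = θ - θ'` from them, in the same units.
  set θ := (1 + θ') / 2 with hθ
  set c := (1 - θ') / 2 with hc
  have hc0 : 0 < c := by rw [hc]; linarith
  -- With `q = max(p(k),N)` the symbol is at most `(ρq)^{n-2} / (c q^{n-1})`; the factor `2` comes
  -- from `max(|k|,N) ≤ 2q`.
  set C := 2 * ρ ^ (n - 2) / c with hC
  have hC0 : 0 < C := by positivity
  have hlim : Tendsto (fun N => Real.exp 1 ^ 2 * (C * √(tailSum N)) * K) atTop (𝓝 0) := by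
    have h1 : Tendsto (fun N => √(tailSum N)) atTop (𝓝 0) := by
      have := (Real.continuous_sqrt.tendsto 0).comp tendsto_tailSum
      rwa [Real.sqrt_zero] at this
    have h2 := ((h1.const_mul C).const_mul (Real.exp 1 ^ 2)).mul_const K
    rwa [mul_zero, mul_zero, zero_mul] at h2
  obtain ⟨N₁, hN₁⟩ := eventually_atTop.1 (hlim.eventually (gt_mem_nhds (by norm_num : (0:ℝ) < 1 / 2)))
  -- The `5` bounds `a + h`, as `a ≤ π < 4` and `h < 1`.
  obtain ⟨N₂, hN₂⟩ := exists_nat_ge (5 / (ρ - 2 * Real.pi))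
  refine ⟨max (max N₁ N₂) 1, by simp, θ, by rw [hθ]; linarith, by rw [hθ]; linarith,
    fun N hN => ⟨C * √(tailSum N), by positivity, (hN₁ N ?_).le, fun t ht => ?_⟩⟩
  · exact (le_max_left _ _).trans ((le_max_left _ _).trans hN)
  have hN1 : 1 ≤ N := (le_max_right _ _).trans hN
  have hNN₂ : N₂ ≤ N := (le_max_right _ _).trans ((le_max_left _ _).trans hN)
  have hq : ∀ j : ℕ, 2 * Real.pi * j + a + h ≤ ρ * (max j N : ℕ) := by
    intro j
    have h1 : (j : ℝ) ≤ (max j N : ℕ) := by exact_mod_cast le_max_left _ _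
    have h2 : (N₂ : ℝ) ≤ (max j N : ℕ) := by exact_mod_cast hNN₂.trans (le_max_right _ _)
    have h3 : 5 ≤ (ρ - 2 * Real.pi) * (max j N : ℕ) := by
      rw [← div_le_iff₀' (by linarith)]
      exact hN₂.trans h2
    have h4 := Real.pi_lt_four
    nlinarith
  have hfreq : ∀ k, blochFreq t k = ((2 * Real.pi * k + a : ℝ) : ℂ) + (t - a) := by
    intro k; rw [blochFreq]; push_cast; ring
  have hnorm : ∀ k : ℤ, ‖((2 * Real.pi * k + a : ℝ) : ℂ)‖ = 2 * Real.pi * p k + a := by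
    intro k; rw [Complex.norm_real, Real.norm_eq_abs, hp]
  have hfreq_le : ∀ k, ‖Complex.I * blochFreq t k‖ ≤ ρ * (max (p k) N : ℕ) := by
    intro k
    rw [norm_mul, Complex.norm_I, one_mul, hfreq]
    refine (norm_add_le _ _).trans (le_trans ?_ (hq (p k)))
    rw [hnorm]
    linarith
  have hnear : ∀ k, ‖(Complex.I * blochFreq t k) ^ n - diskCenter n a (p k)‖ ≤
      θ' * (max (p k) N : ℕ) ^ (n - 1) := by
    intro k
    rw [hp.diskCenter_eq hn_even]
    refine (norm_pow_sub_pow_le _ _ n).trans ?_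
    have h1 : ‖Complex.I * blochFreq t k - Complex.I * ((2 * Real.pi * k + a : ℝ) : ℂ)‖ ≤ h := by
      rw [← mul_sub, norm_mul, Complex.norm_I, one_mul, hfreq, add_sub_cancel_left]
      exact ht
    have h2 : max ‖Complex.I * blochFreq t k‖ ‖Complex.I * ((2 * Real.pi * k + a : ℝ) : ℂ)‖ ≤
        ρ * (max (p k) N : ℕ) := by
      refine max_le (hfreq_le k) ?_
      rw [norm_mul, Complex.norm_I, one_mul, hnorm]
      linarith [hq (p k)]
    calc _ ≤ n * (ρ * (max (p k) N : ℕ)) ^ (n - 1) * h := by gcongr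
      _ = _ := by rw [hθ', mul_pow]; ring
  refine ⟨fun k => (hnear k).trans (by gcongr; rw [hθ]; linarith), fun w hw => ?_⟩
  have hq0 : ∀ k, (0 : ℝ) < (max (p k) N : ℕ) := fun k => by
    exact_mod_cast lt_of_lt_of_le hN1 (le_max_right _ _)
  have hdist : ∀ k, c * (max (p k) N : ℕ) ^ (n - 1) ≤ ‖(Complex.I * blochFreq t k) ^ n - w‖ := by
    intro k
    have h1 := hw (p k)
    have h2 := hnear k
    have h3 := norm_sub_le_norm_sub_add_norm_sub w ((Complex.I * blochFreq t k) ^ n)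
      (diskCenter n a (p k))
    rw [norm_sub_rev w ((Complex.I * blochFreq t k) ^ n)] at h3
    have h4 : c * (max (p k) N : ℕ) ^ (n - 1) = θ * (max (p k) N : ℕ) ^ (n - 1) -
      θ' * (max (p k) N : ℕ) ^ (n - 1) := by rw [hc, hθ]; ring
    linarith
  have hmult : ∀ i, i + 2 ≤ n → ∀ k,
      ‖freeMultiplier n t w i k‖ ≤ C * (1 / max |(k : ℝ)| N) := by
    intro i hi k
    set q : ℝ := ((max (p k) N : ℕ) : ℝ) with hqdef
    have hq1 : 1 ≤ q := by
      rw [hqdef]; exact_mod_cast hN1.trans (le_max_right _ _)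
    have hρq : 1 ≤ ρ * q := by nlinarith [Real.pi_gt_three]
    have hmax : max |(k : ℝ)| N ≤ 2 * q := by
      have h1 : (p k : ℝ) ≤ q := by rw [hqdef]; exact_mod_cast le_max_left _ _
      have h2 : (N : ℝ) ≤ q := by rw [hqdef]; exact_mod_cast le_max_right _ _
      exact max_le (by linarith [hp.abs_le ha haπ k]) (by linarith)
    have hmax0 : 0 < max |(k : ℝ)| N := lt_max_of_lt_right (by exact_mod_cast hN1)
    have hnum : ‖Complex.I * blochFreq t k‖ ^ i ≤ (ρ * q) ^ (n - 2) :=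
      (pow_le_pow_left₀ (norm_nonneg _) (hfreq_le k) i).trans
        (pow_le_pow_right₀ hρq (by omega))
    have hqn : q ^ (n - 1) = q ^ (n - 2) * q := by
      rw [← pow_succ]; congr 1; omega
    rw [freeMultiplier, norm_div, norm_pow]
    calc _ ≤ (ρ * q) ^ (n - 2) / (c * q ^ (n - 1)) :=
          div_le_div₀ (by positivity) hnum (by positivity) (hdist k)
      _ = C * (1 / (2 * q)) := by
          rw [hqn, mul_pow, hC]; field_simp
      _ ≤ _ := by gcongr
  refine ⟨fun k heq => ?_, fun i hi => ?_⟩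
  · have h1 := hdist k
    rw [heq, sub_self, norm_zero] at h1
    have h2 : 0 < c * ((max (p k) N : ℕ) : ℝ) ^ (n - 1) := mul_pos hc0 (pow_pos (hq0 k) _)
    linarith
  · have hts : 0 ≤ tailSum N := tsum_nonneg fun _ => by positivity
    rw [mul_pow, Real.sq_sqrt hts, tailSum, ← tsum_mul_left]
    refine (summable_sq_freeMultiplier t w (by omega)).tsum_le_tsum (fun k => ?_)
      ((summable_tailTerm N).mul_left _)
    rw [← mul_pow]
    exact pow_le_pow_left₀ (norm_nonneg _) (hmult i hi k) 2

end Localization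

/-! ### Counting the eigenvalues -/

section Count

variable {n m : ℕ} {a : ℝ} {p : ℤ → ℕ}

theorem three_mul_max_pow_le (hn : 2 ≤ n) (ha : 0 ≤ a) {i j : ℕ} (hij : i ≠ j) :
    3 * ((max i j : ℕ) : ℝ) ^ (n - 1) ≤ ‖diskCenter n a i - diskCenter n a j‖ := by
  rcases lt_or_gt_of_ne hij with h | h
  · rw [norm_sub_rev, norm_diskCenter_sub ha h.le, max_eq_right h.le]
    exact three_mul_pow_le hn ha h
  · rw [norm_diskCenter_sub ha h.le, max_eq_left h.le]
    exact three_mul_pow_le hn ha h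

theorem abs_im_le_norm_sub_ofReal (t : ℂ) (a : ℝ) : |t.im| ≤ ‖t - a‖ := by
  simpa using Complex.abs_im_le_norm (t - a)

/-- Points of the closed annulus between the radii `θ j^(n-1)` and `j^(n-1)` around the `j`-th
center avoid all the smaller disks. -/
theorem le_norm_sub_diskCenter_of_annulus (hn : 2 ≤ n) (ha : 0 ≤ a) {θ : ℝ} (hθ : θ < 1)
    {N j : ℕ} (hj : N ≤ j) {w : ℂ}
    (h1 : θ * (j : ℝ) ^ (n - 1) ≤ ‖w - diskCenter n a j‖)
    (h2 : ‖w - diskCenter n a j‖ ≤ (j : ℝ) ^ (n - 1)) (i : ℕ) :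
    θ * ((max i N : ℕ) : ℝ) ^ (n - 1) ≤ ‖w - diskCenter n a i‖ := by
  rcases eq_or_ne i j with rfl | hij
  · rwa [max_eq_left hj]
  · have h3 := three_mul_max_pow_le hn ha hij
    have h4 := norm_sub_le_norm_sub_add_norm_sub (diskCenter n a i) w (diskCenter n a j)
    rw [norm_sub_rev _ w] at h4
    have h5 : (j : ℝ) ^ (n - 1) ≤ ((max i j : ℕ) : ℝ) ^ (n - 1) := by
      gcongr; exact le_max_right _ _
    have h6 : ((max i N : ℕ) : ℝ) ^ (n - 1) ≤ ((max i j : ℕ) : ℝ) ^ (n - 1) := by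
      gcongr
    have h7 : θ * ((max i N : ℕ) : ℝ) ^ (n - 1) ≤ 1 * ((max i N : ℕ) : ℝ) ^ (n - 1) := by
      gcongr
    have h8 : (0 : ℝ) ≤ ((max i N : ℕ) : ℝ) ^ (n - 1) := by positivity
    linarith

/-- Points whose absolute value lies between those of the disks with `j < N` and those with
`j ≥ N` avoid all the disks. -/
theorem le_norm_sub_diskCenter_of_norm (ha : 0 ≤ a) (hn : 2 ≤ n) {N : ℕ}
    {w : ℂ} (h1 : ∀ j < N, (2 * Real.pi * j + a) ^ n + (N : ℝ) ^ (n - 1) ≤ ‖w‖)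
    (h2 : ‖w‖ ≤ (2 * Real.pi * N + a) ^ n - (N : ℝ) ^ (n - 1)) (i : ℕ) :
    ((max i N : ℕ) : ℝ) ^ (n - 1) ≤ ‖w - diskCenter n a i‖ := by
  have h4 : ‖w‖ - ‖diskCenter n a i‖ ≤ ‖w - diskCenter n a i‖ := norm_sub_norm_le _ _
  have h5 : ‖diskCenter n a i‖ - ‖w‖ ≤ ‖w - diskCenter n a i‖ := by
    rw [norm_sub_rev]; exact norm_sub_norm_le _ _
  rw [norm_diskCenter ha] at h4 h5
  rcases lt_trichotomy i N with h | rfl | h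
  · rw [max_eq_right h.le]
    linarith [h1 i h]
  · rw [max_self]; linarith
  · rw [max_eq_left h.le]
    have h6 := three_mul_pow_le hn ha h
    have h7 : (0 : ℝ) ≤ (N : ℝ) ^ (n - 1) := by positivity
    have h8 : (0 : ℝ) ≤ (i : ℝ) ^ (n - 1) := by positivity
    linarith

/-- The lower bound for the points of the disks with `k ≥ N`. -/
theorem outer_radius_le (hn : 2 ≤ n) (ha : 0 ≤ a) {N k : ℕ} (hk : N ≤ k) :
    (2 * Real.pi * N + a) ^ n - (N : ℝ) ^ (n - 1) ≤
      (2 * Real.pi * k + a) ^ n - (k : ℝ) ^ (n - 1) := by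
  rcases hk.eq_or_lt with rfl | h
  · exact le_rfl
  · have h6 := three_mul_pow_le hn ha h
    have h7 : (0 : ℝ) ≤ (N : ℝ) ^ (n - 1) := by positivity
    have h8 : (0 : ℝ) ≤ (k : ℝ) ^ (n - 1) := by positivity
    linarith

/-- Treats `a = 0` and `a = π` together. The two cases differ only in the enumeration `p` of the
disks and in the number `S N` of indices that fall into the first `N` of them. -/
theorem exists_localized_and_count (hn : 2 ≤ n) (hn_even : Even n) (ha : 0 ≤ a)
    (haπ : a ≤ Real.pi) (hp : IsDiskIndex a p) {h : ℝ} (h_pos : 0 < h) (h_lt : h < 1)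
    (h_small : n * (2 * Real.pi) ^ (n - 1) * h < 1) {P : ℕ → ℝ → Matrix (Fin m) (Fin m) ℂ}
    (hP : ∀ ν ∈ Finset.Icc 2 n, ∀ i j, MemLp (fun x => P ν x i j) 2 unitMeasure)
    (hp2 : ∀ j, 1 ≤ j → ∃ s : Finset ℤ, s.card = 2 ∧ ∀ k, k ∈ s ↔ p k = j) {S : ℕ → ℕ}
    (hpS : ∀ N, 1 ≤ N → ∃ s : Finset ℤ, s.card = S N ∧ ∀ k, k ∈ s ↔ p k < N) :
    ∃ N₀ : ℕ, 0 < N₀ ∧ ∀ N ≥ N₀,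
      EigenvaluesLocalized n P a h N ∧
      (∀ t : ℂ, ‖t - a‖ ≤ h → ∀ k ≥ N,
        HasEigenvalueCount (blochOperator n P t)
          (eigenDisk n a k ((k : ℝ) ^ (n - 1))) (2 * m)) ∧
      ∃ Γ : Set ℂ, EnclosesRemaining n P a h N (S N * m) Γ := by
  obtain ⟨N₀, hN₀, θ, hθ0, hθ1, hN⟩ :=
    exists_freeBound hn hn_even ha haπ hp h_pos h_lt h_small (potentialNorm n P)
  refine ⟨N₀, hN₀, fun N hNN => ?_⟩
  obtain ⟨δ, hδ, hδP, hfree⟩ := hN N hNN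
  have hN1 : 1 ≤ N := le_trans hN₀ hNN
  have him : ∀ t : ℂ, ‖t - a‖ ≤ h → |t.im| ≤ 1 := fun t ht =>
    (abs_im_le_norm_sub_ofReal t a).trans (ht.trans h_lt.le)
  have hθle : ∀ x : ℝ, 0 ≤ x → θ * x ≤ x := fun x hx => mul_le_of_le_one_left hx hθ1.le
  have hloc : EigenvaluesLocalized n P a h N := by
    intro t ht z hz μ hμ
    by_contra hcon
    push Not at hcon
    refine not_isEigenvalue_blochOperator hn hP (him t ht) hδ hδP
      ((hfree t ht).2 μ fun j => ?_) hz hμ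
    refine (hθle _ (by positivity)).trans ?_
    rcases lt_or_ge j N with hj | hj
    · rw [max_eq_right hj.le]
      exact not_lt.1 fun hlt => hcon.1 j hj (mem_ball_iff_norm.2 hlt)
    · rw [max_eq_left hj]
      exact not_lt.1 fun hlt => hcon.2 j hj (mem_ball_iff_norm.2 hlt)
  refine ⟨hloc, fun t ht j hj => ?_, ?_⟩
  · obtain ⟨s, hs2, hs⟩ := hp2 j (hN1.trans hj)
    have hj0 : (0 : ℝ) < (j : ℝ) ^ (n - 1) := by
      have : (0 : ℝ) < j := by exact_mod_cast lt_of_lt_of_le hN1 hj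
      positivity
    rw [← hs2]
    refine hasEigenvalueCount_blochOperator hn hP (him t ht) hδ hδP (mul_pos hθ0 hj0)
      (mul_lt_of_lt_one_left hj0 hθ1) (fun w h1 h2 => (hfree t ht).2 w
        (le_norm_sub_diskCenter_of_annulus hn ha hθ1 hj h1 h2)) s fun k => ?_
    rw [hs]
    have hk := (hfree t ht).1 k
    constructor
    · rintro rfl
      rw [max_eq_left hj] at hk
      exact hk.trans_lt (mul_lt_of_lt_one_left hj0 hθ1)
    · intro hlt
      -- A free eigenvalue of another disk would lie within `M = max(p(k),j)^{n-1}` of both centers,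
      -- which are at least `3M` apart.
      by_contra hne
      have h3 := three_mul_max_pow_le hn ha hne
      have h4 := norm_sub_le_norm_sub_add_norm_sub (diskCenter n a (p k))
        ((Complex.I * blochFreq t k) ^ n) (diskCenter n a j)
      rw [norm_sub_rev _ ((Complex.I * blochFreq t k) ^ n)] at h4
      have h5 : (j : ℝ) ^ (n - 1) ≤ ((max (p k) j : ℕ) : ℝ) ^ (n - 1) := by
        gcongr; exact le_max_right _ _
      have h6 : ((max (p k) N : ℕ) : ℝ) ^ (n - 1) ≤ ((max (p k) j : ℕ) : ℝ) ^ (n - 1) := by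
        gcongr
      have h7 := hθle (((max (p k) N : ℕ) : ℝ) ^ (n - 1)) (by positivity)
      linarith
  · have hN0 : (0 : ℝ) < (N : ℝ) ^ (n - 1) := by
      have : (0 : ℝ) < N := by exact_mod_cast hN1
      positivity
    -- `R₁` bounds the disks of radius `N^{n-1}` with index below `N`, and `R₂` is the distance from
    -- `0` to the `N`-th disk. The closed annulus between them meets none of the open disks, and its
    -- outer circle serves as `Γ`.
    set R₁ : ℝ := (2 * Real.pi * (N - 1 : ℕ) + a) ^ n + (N : ℝ) ^ (n - 1) with hR₁
    set R₂ : ℝ := (2 * Real.pi * N + a) ^ n - (N : ℝ) ^ (n - 1) with hR₂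
    have hpi := Real.pi_pos
    have hR10 : 0 < R₁ := by positivity
    have hR12 : R₁ < R₂ := by
      have := three_mul_pow_le hn ha (Nat.sub_lt hN1 one_pos)
      linarith
    have hR20 := hR10.trans hR12
    have hinner : ∀ j < N, (2 * Real.pi * j + a) ^ n + (N : ℝ) ^ (n - 1) ≤ R₁ := by
      intro j hj
      have : (j : ℝ) ≤ (N - 1 : ℕ) := by exact_mod_cast Nat.le_sub_one_of_lt hj
      rw [hR₁]
      gcongr
    have hann : ∀ t : ℂ, ‖t - a‖ ≤ h → ∀ w : ℂ, R₁ ≤ ‖w‖ → ‖w‖ ≤ R₂ → FreeBound n t δ w :=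
      fun t ht w h1 h2 => (hfree t ht).2 w fun j => (hθle _ (by positivity)).trans
        (le_norm_sub_diskCenter_of_norm ha hn (fun j hj => (hinner j hj).trans h1) h2 j)
    refine ⟨Metric.sphere 0 R₂, isSimpleClosedCurve_sphere 0 hR20, fun t ht => ⟨fun μ hμ => ?_, ?_⟩⟩
    · have hμ1 : IsEigenvalue (blochOperator n (fun ν x => ((1 : ℝ) : ℂ) • P ν x) t) μ := by
        simpa using hμ
      have h01 : (1 : ℝ) ∈ Icc (0 : ℝ) 1 := by simp
      refine ⟨fun hmem => ?_, ?_⟩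
      · have hnorm := mem_sphere_zero_iff_norm.1 hmem
        exact not_isEigenvalue_blochOperator hn hP (him t ht) hδ hδP
          (hann t ht μ (hnorm ▸ hR12.le) hnorm.le) h01 hμ1
      · rw [inside_sphere_zero hR20, mem_ball_zero_iff]
        constructor
        · intro hlt k hk hmem
          have h1 : ‖μ - diskCenter n a k‖ < (k : ℝ) ^ (n - 1) := mem_ball_iff_norm.1 hmem
          have h2 : ‖diskCenter n a k‖ - ‖μ‖ ≤ ‖μ - diskCenter n a k‖ := by
            rw [norm_sub_rev]; exact norm_sub_norm_le _ _
          rw [norm_diskCenter ha] at h2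
          linarith [outer_radius_le hn ha hk]
        · intro hout
          rcases hloc t ht 1 h01 μ hμ1 with ⟨k, hk, hmem⟩ | ⟨k, hk, hmem⟩
          · have h1 : ‖μ - diskCenter n a k‖ < (N : ℝ) ^ (n - 1) := mem_ball_iff_norm.1 hmem
            have h2 : ‖μ‖ - ‖diskCenter n a k‖ ≤ ‖μ - diskCenter n a k‖ := norm_sub_norm_le _ _
            rw [norm_diskCenter ha] at h2
            linarith [hinner k hk]
          · exact absurd hmem (hout k hk)
    · obtain ⟨s, hsS, hs⟩ := hpS N hN1
      rw [inside_sphere_zero hR20, ← hsS]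
      refine hasEigenvalueCount_blochOperator hn hP (him t ht) hδ hδP hR10 hR12
        (fun w h1 h2 => hann t ht w (by simpa using h1) (by simpa using h2)) s fun k => ?_
      rw [hs, sub_zero]
      have hk := (hfree t ht).1 k
      have h1 : ‖(Complex.I * blochFreq t k) ^ n‖ - ‖diskCenter n a (p k)‖ ≤ _ :=
        norm_sub_norm_le ((Complex.I * blochFreq t k) ^ n) (diskCenter n a (p k))
      have h2 : ‖diskCenter n a (p k)‖ - ‖(Complex.I * blochFreq t k) ^ n‖ ≤
          ‖(Complex.I * blochFreq t k) ^ n - diskCenter n a (p k)‖ := by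
        rw [norm_sub_rev]; exact norm_sub_norm_le _ _
      rw [norm_diskCenter ha] at h1 h2
      have h3 := hθle (((max (p k) N : ℕ) : ℝ) ^ (n - 1)) (by positivity)
      constructor
      · intro hlt
        rw [max_eq_right hlt.le] at hk h3
        linarith [hinner (p k) hlt]
      · intro hlt
        by_contra hge
        have hge := not_lt.1 hge
        rw [max_eq_left hge] at hk h3
        linarith [outer_radius_le hn ha hge]

theorem isDiskIndex_natAbs : IsDiskIndex 0 Int.natAbs := by
  intro k
  rw [add_zero, add_zero, abs_mul, abs_of_pos Real.two_pi_pos, Nat.cast_natAbs, Int.cast_abs]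

/-- The index of the disk around `((2πk + π)i)^n`. -/
def antiperiodicIndex (k : ℤ) : ℕ := if 0 ≤ k then k.toNat else (-k - 1).toNat

theorem isDiskIndex_antiperiodicIndex : IsDiskIndex Real.pi antiperiodicIndex := by
  intro k
  have hpi := Real.pi_pos
  rw [antiperiodicIndex]
  split_ifs with hk
  · lift k to ℕ using hk
    rw [Int.toNat_natCast, Int.cast_natCast, abs_of_nonneg (by positivity)]
  · obtain ⟨j, rfl⟩ : ∃ j : ℕ, k = -j - 1 := ⟨(-k - 1).toNat, by omega⟩
    have : (-(-(j : ℤ) - 1) - 1).toNat = j := by omega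
    rw [this, abs_of_nonpos]
    · push_cast; ring
    · push_cast
      have : 0 ≤ Real.pi * j := by positivity
      nlinarith

end Count

end

/-! ### The periodic and the antiperiodic case -/

theorem theorem8 (n m : ℕ) (hn : 2 ≤ n) (hn_even : Even n)
    (P : ℕ → ℝ → Matrix (Fin m) (Fin m) ℂ)
    (hP_per : ∀ ν ∈ Finset.Icc 2 n, Function.Periodic (P ν) 1)
    (hP_reg : ∀ ν ∈ Finset.Icc 2 n, ∀ i j,
      SquareIntegrableDeriv (n - ν) (fun x => P ν x i j))
    (hC : (Matrix.of fun i j => ∫ x in (0 : ℝ)..1, P 2 x i j).charpoly.roots.Nodup)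
    (h : ℝ) (h_pos : 0 < h) (h_lt : h < 1 / (15 * Real.pi))
    (h_small : n * (2 * Real.pi) ^ (n - 1) * h < 1) :
    (∃ N₀ : ℕ, 0 < N₀ ∧ ∀ N ≥ N₀,
      EigenvaluesLocalized n P 0 h N ∧
      (∀ t : ℂ, ‖t‖ ≤ h → ∀ k ≥ N,
        HasEigenvalueCount (blochOperator n P t)
          (eigenDisk n 0 k ((k : ℝ) ^ (n - 1))) (2 * m)) ∧
      ∃ Γ : Set ℂ, EnclosesRemaining n P 0 h N ((2 * N - 1) * m) Γ) ∧
    (∃ N₀ : ℕ, 0 < N₀ ∧ ∀ N ≥ N₀,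
      EigenvaluesLocalized n P Real.pi h N ∧
      (∀ t : ℂ, ‖t - Real.pi‖ ≤ h → ∀ k ≥ N,
        HasEigenvalueCount (blochOperator n P t)
          (eigenDisk n Real.pi k ((k : ℝ) ^ (n - 1))) (2 * m)) ∧
      ∃ Γ : Set ℂ, EnclosesRemaining n P Real.pi h N (2 * m * N) Γ) := by
  have hpi := Real.pi_pos
  have h_lt_one : h < 1 := h_lt.trans_le <| by
    rw [div_le_one (by positivity)]
    linarith [Real.pi_gt_three]
  have hP : ∀ ν ∈ Finset.Icc 2 n, ∀ i j, MemLp (fun x => P ν x i j) 2 unitMeasure :=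
    fun ν hν i j => (hP_reg ν hν i j).memLp
  constructor
  -- Here `p(k) = |k|`: the indices `j` and `-j` share a disk, `0` is alone, and `|k| < N` has `2N -
  -- 1` solutions.
  · obtain ⟨N₀, hN₀, H⟩ := exists_localized_and_count (S := fun N => 2 * N - 1) hn hn_even le_rfl
      hpi.le isDiskIndex_natAbs h_pos h_lt_one h_small hP
      (fun j hj => ⟨{(j : ℤ), -(j : ℤ)}, Finset.card_pair (by omega), fun k => by
        rw [Finset.mem_insert, Finset.mem_singleton]; omega⟩)
      (fun N hN => ⟨Finset.Ioo (-(N : ℤ)) N, by rw [Int.card_Ioo]; omega, fun k => by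
        rw [Finset.mem_Ioo]; omega⟩)
    refine ⟨N₀, hN₀, fun N hN => ⟨(H N hN).1, fun t ht => (H N hN).2.1 t (by simpa using ht),
      (H N hN).2.2⟩⟩
  -- Here `2π(-j-1) + π = -(2πj + π)` pairs `j` with `-j - 1`, also for `j = 0`, and the first `N`
  -- disks receive `-N ≤ k < N`.
  · obtain ⟨N₀, hN₀, H⟩ := exists_localized_and_count (S := fun N => 2 * N) hn hn_even hpi.le
      le_rfl isDiskIndex_antiperiodicIndex h_pos h_lt_one h_small hP
      (fun j hj => ⟨{(j : ℤ), -(j : ℤ) - 1}, Finset.card_pair (by omega), fun k => by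
        rw [Finset.mem_insert, Finset.mem_singleton, antiperiodicIndex]; split_ifs <;> omega⟩)
      (fun N hN => ⟨Finset.Ico (-(N : ℤ)) N, by rw [Int.card_Ico]; omega, fun k => by
        rw [Finset.mem_Ico, antiperiodicIndex]; split_ifs <;> omega⟩)
    refine ⟨N₀, hN₀, fun N hN => ⟨(H N hN).1, (H N hN).2.1, ?_⟩⟩
    rw [mul_right_comm]
    exact (H N hN).2.2
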